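/- **Theorem (Bernstein–von Mises theorem for linear discriminant analysis).** For each sample size $n$ let $p=p_n$ be the dimension, let $z,\mu_X^*,\mu_Y^*\in\mathbb R^{p}$ be fixed (non-random) vectors, and let $\Sigma^*$ be a positive definite $p\times p$ matrix with $\Omega^*=\Sigma^{*-1}$ (all may depend on $n$). Let $X_1,\dots,X_n$ be i.i.d. $N(\mu_X^*,\Sigma^*)$ and, independently, $Y_1,\dots,Y_n$ i.i.d. $N(\mu_Y^*,\Sigma^*)$; $o_P(1)$ refers to this law as $n\to\infty$. Let $\|\cdot\|$ be the Euclidean norm of vectors and the spectral norm of matrices, and $\|\cdot\|_F$ the Frobenius norm. Put $$\Delta(\mu_X,\mu_Y,\Omega)=-(z-\mu_X)^T\Omega(z-\mu_X)+(z-\mu_Y)^T\Omega(z-\mu_Y),$$ $$l_n(\mu_X,\mu_Y,\Omega)=n\log\det\Omega-\tfrac n2\operatorname{tr}\big(\Omega(\tilde\Sigma_X+\tilde\Sigma_Y)\big),$$ $$\tilde\Sigma_X=\tfrac1n\sum_{i=1}^n(X_i-\mu_X)(X_i-\mu_X)^T,\qquad \tilde\Sigma_Y=\tfrac1n\sum_{i=1}^n(Y_i-\mu_Y)(Y_i-\mu_Y)^T.$$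 Let $\Pi=\Pi_n$ be a prior, i.e. a probability measure on the parameters $(\mu_X,\mu_Y,\Omega)$ with $\Omega$ positive definite, and let $\Pi(B\mid X^n,Y^n)=\int_B e^{l_n}\,d\Pi\big/\int e^{l_n}\,d\Pi$ be the posterior distribution. Put $$\Phi=\tfrac12\Omega^*\Big((z-\mu_X^*)(z-\mu_X^*)^T-(z-\mu_Y^*)(z-\mu_Y^*)^T\Big)\Omega^*,\qquad \xi_X=2(z-\mu_X^*),\qquad \xi_Y=2(\mu_Y^*-z),$$ $$V^2=4\big\|\Sigma^{*1/2}\Phi\Sigma^{*1/2}\big\|_F^2+\xi_X^T\Omega^*\xi_X+\xi_Y^T\Omega^*\xi_Y,\qquad V\ge 0,$$ $$\Omega_t=\Omega+\frac{2t}{\sqrt n\,V}\Phi,\qquad \mu_{X,t}=\mu_X-\frac{t}{\sqrt n\,V}\xi_X,\qquad \mu_{Y,t}=\mu_Y-\frac{t}{\sqrt n\,V}\xi_Y,$$ $$\hat\Sigma=\tfrac12\Big(\tfrac1n\sum_{i=1}^n(X_i-\bar X)(X_i-\bar X)^T+\tfrac1n\sum_{i=1}^n(Y_i-\bar Y)(Y_i-\bar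 Y)^T\Big),\qquad \hat\Delta=\Delta(\bar X,\bar Y,\hat\Sigma^{-1}).$$ Let $A_n$ be measurable sets of parameters (with $\Omega$ positive definite) such that, writing $\Sigma=\Omega^{-1}$, for some deterministic sequence $\delta_n\to0$, every $(\mu_X,\mu_Y,\Omega)\in A_n$ satisfies $$\sqrt n\big(\|\mu_X-\mu_X^*\|^2+\|\mu_Y-\mu_Y^*\|^2+\|\Sigma-\Sigma^*\|^2\big)\ \vee\ \sqrt p\big(\|\mu_X-\mu_X^*\|+\|\mu_Y-\mu_Y^*\|+\|\Sigma-\Sigma^*\|\big)\le\delta_n .$$ Assume $\|\Sigma^*\|\vee\|\Omega^*\|=O(1)$, $p^2/n=o(1)$, $V^{-1}=O(1)$ (in particular $V>0$ for all large $n$), and 1. $\Pi(A_n\mid X^n,Y^n)=1-o_P(1)$; 2. for every fixed $t\in\mathbb R$, $$\frac{\int_{A_n}\exp\big(l_n(\mu_{X,t},\mu_{Y,t},\Omega_t)\big)\,d\Pi(\mu_X,\mu_Y,\Omega)}{\int_{A_n}\exp\big(l_n(\mu_X,\mu_Y,\Omega)\big)\,d\Pi(\mu_X,\mu_Y,\Omega)}=1+o_P(1).$$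 (For fixed $t$ and all large $n$, $\Omega_t$ is positive definite on $A_n$; before that, $\log\det\Omega_t$ may be given any value.) Then $$\sup_{t\in\mathbb R}\Big|\Pi\Big(\sqrt n\,V^{-1}\big(\Delta(\mu_X,\mu_Y,\Omega)-\hat\Delta\big)\le t\,\Big|\,X^n,Y^n\Big)-\mathbb P(Z\le t)\Big|=o_P(1),\qquad Z\sim N(0,1).$$ -/

import Mathlib

open MeasureTheory ProbabilityTheory Filter Topology
open scoped Matrix MatrixOrder ENNReal

noncomputable section

namespace LDA

/-- `ℝᵖ` with its Euclidean norm. -/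
abbrev Vec (p : ℕ) : Type := EuclideanSpace ℝ (Fin p)

/-- Real `p × p` matrices. -/
abbrev Mat (p : ℕ) : Type := Matrix (Fin p) (Fin p) ℝ

/-- The spectral norm `‖A‖`: the operator norm of `A` on Euclidean space. -/
def specNorm {p : ℕ} (A : Mat p) : ℝ := ‖Matrix.toEuclideanCLM (n := Fin p) (𝕜 := ℝ) A‖

/-- The squared Frobenius norm `‖A‖_F²`. -/
def frobSq {p : ℕ} (A : Mat p) : ℝ := ∑ i, ∑ j, A i j ^ 2

/-- The outer product `x yᵀ`. -/
def outer {p : ℕ} (x y : Vec p) : Mat p := Matrix.of fun i j => x i * y j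

/-- The quadratic form `xᵀ A x`. -/
def quadForm {p : ℕ} (A : Mat p) (x : Vec p) : ℝ := ∑ i, ∑ j, x i * A i j * x j

/-- A parameter `(μ_X, μ_Y, Ω)`: two means and one (common) precision matrix. -/
abbrev Param (p : ℕ) : Type := Vec p × Vec p × (Fin p → Fin p → ℝ)

namespace Param

variable {p : ℕ}

/-- The mean `μ_X`. -/
def muX (θ : Param p) : Vec p := θ.1

/-- The mean `μ_Y`. -/
def muY (θ : Param p) : Vec p := θ.2.1

/-- The precision matrix `Ω`. -/
def prec (θ : Param p) : Mat p := Matrix.of θ.2.2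

/-- The covariance matrix `Σ = Ω⁻¹`. -/
def cov (θ : Param p) : Mat p := θ.prec⁻¹

end Param

/-- The data `(Xⁿ, Yⁿ)`: two training samples of size `n` in `ℝᵖ`. -/
abbrev Data (n p : ℕ) : Type := (Fin n → Vec p) × (Fin n → Vec p)

/-- The (fixed) point `z` to be classified together with the true values
`μ_X*`, `μ_Y*`, `Σ*`, where `Σ*` is positive definite. -/
structure Truth (p : ℕ) where
  z : Vec p
  muX : Vec p
  muY : Vec p
  cov : Mat p
  posDef : cov.PosDef

/-- The LDA functional
`Δ(μ_X, μ_Y, Ω) = -(z - μ_X)ᵀ Ω (z - μ_X) + (z - μ_Y)ᵀ Ω (z - μ_Y)`. -/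
def functional {p : ℕ} (z μX μY : Vec p) (Om : Mat p) : ℝ :=
  -quadForm Om (z - μX) + quadForm Om (z - μY)

namespace Truth

variable {p : ℕ} (T : Truth p)

/-- `Ω* = (Σ*)⁻¹`. -/
def prec : Mat p := T.cov⁻¹

/-- `Φ = ½ Ω* ((z - μ_X*)(z - μ_X*)ᵀ - (z - μ_Y*)(z - μ_Y*)ᵀ) Ω*`. -/
def Phi : Mat p :=
  (1 / 2 : ℝ) •
    (T.prec * (outer (T.z - T.muX) (T.z - T.muX) - outer (T.z - T.muY) (T.z - T.muY)) * T.prec)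

/-- `ξ_X = 2 (z - μ_X*)`. -/
def xiX : Vec p := (2 : ℝ) • (T.z - T.muX)

/-- `ξ_Y = 2 (μ_Y* - z)`. -/
def xiY : Vec p := (2 : ℝ) • (T.muY - T.z)

/-- `V² = 4 ‖Σ*^{1/2} Φ Σ*^{1/2}‖_F² + ξ_Xᵀ Ω* ξ_X + ξ_Yᵀ Ω* ξ_Y`. -/
def V2 : ℝ :=
  4 * frobSq (CFC.sqrt T.cov * T.Phi * CFC.sqrt T.cov)
    + quadForm T.prec T.xiX + quadForm T.prec T.xiY

/-- `V`, the nonnegative square root of `V²`. -/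
def V : ℝ := √T.V2

/-- The law of the data under the truth: `X₁, …, Xₙ` i.i.d. `N(μ_X*, Σ*)` and, independently of
them, `Y₁, …, Yₙ` i.i.d. `N(μ_Y*, Σ*)`. -/
def dataLaw (n : ℕ) : Measure (Data n p) :=
  (Measure.pi fun _ : Fin n => multivariateGaussian T.muX T.cov).prod
    (Measure.pi fun _ : Fin n => multivariateGaussian T.muY T.cov)

/-- The perturbed parameter `(μ_{X,t}, μ_{Y,t}, Ω_t)` with
`μ_{X,t} = μ_X - t ξ_X / (√n V)`, `μ_{Y,t} = μ_Y - t ξ_Y / (√n V)`,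
`Ω_t = Ω + 2 t Φ / (√n V)`. -/
def perturb (n : ℕ) (t : ℝ) (θ : Param p) : Param p :=
  (θ.muX - (t / (√(n : ℝ) * T.V)) • T.xiX,
   θ.muY - (t / (√(n : ℝ) * T.V)) • T.xiY,
   fun i j => θ.prec i j + 2 * t / (√(n : ℝ) * T.V) * T.Phi i j)

/-- The set of parameters, with positive definite precision matrix, such that
`√n (‖μ_X - μ_X*‖² + ‖μ_Y - μ_Y*‖² + ‖Σ - Σ*‖²)
  ∨ √p (‖μ_X - μ_X*‖ + ‖μ_Y - μ_Y*‖ + ‖Σ - Σ*‖) ≤ δ`. -/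
def neighborhood (n : ℕ) (δ : ℝ) : Set (Param p) :=
  {θ | θ.prec.PosDef ∧
    max
      (√(n : ℝ) * (‖θ.muX - T.muX‖ ^ 2 + ‖θ.muY - T.muY‖ ^ 2 + specNorm (θ.cov - T.cov) ^ 2))
      (√(p : ℝ) * (‖θ.muX - T.muX‖ + ‖θ.muY - T.muY‖ + specNorm (θ.cov - T.cov))) ≤ δ}

end Truth

/-- `(1/n) ∑ᵢ (xᵢ - m)(xᵢ - m)ᵀ`. -/
def scatter {n p : ℕ} (x : Fin n → Vec p) (m : Vec p) : Mat p :=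
  (1 / (n : ℝ)) • ∑ i, outer (x i - m) (x i - m)

/-- The sample mean. -/
def sampleMean {n p : ℕ} (x : Fin n → Vec p) : Vec p := (1 / (n : ℝ)) • ∑ i, x i

/-- The pooled sample covariance matrix `Σ̂`. -/
def pooledCov {n p : ℕ} (D : Data n p) : Mat p :=
  (1 / 2 : ℝ) • (scatter D.1 (sampleMean D.1) + scatter D.2 (sampleMean D.2))

/-- The centering `Δ̂ = Δ(X̄, Ȳ, Σ̂⁻¹)`. -/
def centering {n p : ℕ} (z : Vec p) (D : Data n p) : ℝ :=
  functional z (sampleMean D.1) (sampleMean D.2) (pooledCov D)⁻¹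

/-- The Gaussian log-likelihood, without its additive constant, of one sample:
`(n/2) log det Ω - (n/2) tr (Ω Σ̃)` with `Σ̃ = (1/n) ∑ᵢ (xᵢ - μ)(xᵢ - μ)ᵀ`. -/
def logLik₁ {n p : ℕ} (x : Fin n → Vec p) (μ : Vec p) (Om : Mat p) : ℝ :=
  (n : ℝ) / 2 * Real.log Om.det - (n : ℝ) / 2 * (Om * scatter x μ).trace

/-- The log-likelihood `lₙ(μ_X, μ_Y, Ω) = l_X(μ_X, Ω) + l_Y(μ_Y, Ω)`. -/
def logLik {n p : ℕ} (D : Data n p) (θ : Param p) : ℝ :=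
  logLik₁ D.1 θ.muX θ.prec + logLik₁ D.2 θ.muY θ.prec

/-- The posterior probability
`Π(B | Xⁿ, Yⁿ) = ∫_B exp lₙ dΠ / ∫ exp lₙ dΠ` of a set `B` of parameters. -/
def posterior {n p : ℕ} (prior : Measure (Param p)) (D : Data n p) (B : Set (Param p)) : ℝ :=
  ((∫⁻ θ in B, ENNReal.ofReal (Real.exp (logLik D θ)) ∂prior) /
    (∫⁻ θ, ENNReal.ofReal (Real.exp (logLik D θ)) ∂prior)).toReal

/-- The ratio `∫_A exp lₙ(μ_{X,t}, μ_{Y,t}, Ω_t) dΠ / ∫_A exp lₙ(μ_X, μ_Y, Ω) dΠ`. -/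
def perturbedRatio {n p : ℕ} (T : Truth p) (prior : Measure (Param p)) (A : Set (Param p))
    (t : ℝ) (D : Data n p) : ℝ :=
  ((∫⁻ θ in A, ENNReal.ofReal (Real.exp (logLik D (T.perturb n t θ))) ∂prior) /
    (∫⁻ θ in A, ENNReal.ofReal (Real.exp (logLik D θ)) ∂prior)).toReal

/-- `supₜ |Π(√n V⁻¹ (Δ - Δ̂) ≤ t | Xⁿ, Yⁿ) - ℙ(Z ≤ t)|` with `Z ∼ N(0,1)`. -/
def cdfDistance {n p : ℕ} (T : Truth p) (prior : Measure (Param p)) (D : Data n p) : ℝ :=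
  ⨆ t : ℝ,
    |posterior prior D
        {θ | √(n : ℝ) * T.V⁻¹ *
          (functional T.z θ.muX θ.muY θ.prec - centering T.z D) ≤ t}
      - (gaussianReal 0 1).real (Set.Iic t)|

/-- `Rₙ = o_P(1)` under the laws `Pₙ`. -/
def IsLittleOP {S : ℕ → Type*} [∀ n, MeasurableSpace (S n)] (P : ∀ n, Measure (S n))
    (R : ∀ n, S n → ℝ) : Prop :=
  ∀ ε : ℝ, 0 < ε → Tendsto (fun n => P n {ω | ε ≤ |R n ω|}) atTop (𝓝 0)

end LDA

end

/-! The posterior law of the standardized functional W = √n V⁻¹(Δ − Δ̂) is identified through its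
moment generating function. The perturbation by `t` moves the parameter against the gradient of Δ in
the Fisher information metric at the truth, and V² is the squared length of that gradient. A
quadratic expansion of the likelihood therefore gives lₙ(θₜ) − lₙ(θ) = t W(θ) − t²/2 + o(1),
uniformly over θ in Aₙ and with probability tending to one (`abs_logLik_perturb_sub_le`).
Multiplying e^{lₙ} by e^{tW} is then, up to a factor 1 + o(1), the same as replacing e^{lₙ(θ)} by
e^{t²/2} e^{lₙ(θₜ)}; by the change-of-measure hypothesis the posterior restricted to Aₙ has E e^{tW}
→ e^{t²/2} (`lintegral_exp_restrictedLaw_bounds`). Convergence in probability can be used only at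
finitely many `t` at once, and `exists_finset_kolmogorov_le` shows that finitely many suffice for
closeness in Kolmogorov distance. Removing the restriction to Aₙ costs at most the posterior mass
outside Aₙ (`abs_ratio_sub_restrictedLaw_le`).

Two points make the expansion uniform in the dimension and in the possibly unbounded V. The errors
of the log determinant are measured by Frobenius norms, so no factor p appears. The second-order
remainder of Δ has to be O(V), although it is a difference of two quadratic forms in a = z − μ_X*
and b = z − μ_Y* that may each be of size V²; the difference is polarized into a form in a + b and a
− b, and ‖a + b‖‖a − b‖ = O(V) because aaᵀ − bbᵀ is a multiple of Σ*ΦΣ*.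

On the side of the data, second moments are enough (`tendsto_dataLaw_not_goodData`). The error Σ̂ −
Σ* must be small in spectral norm, which follows from the Frobenius norm, of squared order p²/n; a
squared error of order o(n^{-1/2}) is needed only along four fixed directions, where the squared
error is of order p/n. -/

namespace LDA

/-! ### Moment generating functions and Kolmogorov distance to N(0,1) -/

/-- The bounded continuous function `x ↦ min (exp (t x)) M`. -/
noncomputable def truncExp (t : ℝ) (M : NNReal) : BoundedContinuousFunction ℝ NNReal :=
  BoundedContinuousFunction.mkOfBound
    ⟨fun x => min (Real.toNNReal (Real.exp (t * x))) M, by fun_prop⟩ M (by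
      intro x y
      rw [NNReal.dist_eq]
      have h1 : ((min (Real.toNNReal (Real.exp (t * x))) M : NNReal) : ℝ) ≤ M := by
        exact_mod_cast min_le_right _ _
      have h2 : ((min (Real.toNNReal (Real.exp (t * y))) M : NNReal) : ℝ) ≤ M := by
        exact_mod_cast min_le_right _ _
      have h3 := (min (Real.toNNReal (Real.exp (t * x))) M).coe_nonneg
      have h4 := (min (Real.toNNReal (Real.exp (t * y))) M).coe_nonneg
      exact abs_le.2 ⟨by simp only [ContinuousMap.coe_mk]; linarith, by
        simp only [ContinuousMap.coe_mk]; linarith⟩)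

lemma truncExp_apply (t : ℝ) (M : NNReal) (x : ℝ) :
    truncExp t M x = min (Real.toNNReal (Real.exp (t * x))) M := rfl

lemma truncExp_le (t : ℝ) (M : NNReal) (x : ℝ) :
    (truncExp t M x : ℝ≥0∞) ≤ ENNReal.ofReal (Real.exp (t * x)) := by
  rw [truncExp_apply, ENNReal.ofReal]
  exact_mod_cast min_le_left _ _

/-- Where e^{tx} exceeds `M` it is at most e^{2tx}/M. A bound on the moment at `2t` thus makes the
truncation error O(1/M), uniformly over measures. -/
lemma exp_le_truncExp_add (t : ℝ) {M : NNReal} (hM : 0 < M) (x : ℝ) :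
    ENNReal.ofReal (Real.exp (t * x)) ≤
      (truncExp t M x : ℝ≥0∞) + (M : ℝ≥0∞)⁻¹ * ENNReal.ofReal (Real.exp (2 * t * x)) := by
  rw [truncExp_apply]
  rcases le_total (Real.toNNReal (Real.exp (t * x))) M with h | h
  · rw [min_eq_left h]
    exact le_self_add
  · refine le_add_left ?_
    have hM' : (M : ℝ≥0∞) ≠ 0 := by exact_mod_cast hM.ne'
    rw [← ENNReal.div_eq_inv_mul, ENNReal.le_div_iff_mul_le (Or.inl hM') (Or.inl ENNReal.coe_ne_top)]
    rw [show 2 * t * x = t * x + t * x by ring, Real.exp_add,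
      ENNReal.ofReal_mul (Real.exp_pos _).le]
    gcongr
    rw [ENNReal.ofReal]
    exact_mod_cast h

/-- Weak convergence controls only the truncated exponentials. The upper bound follows by monotone
convergence in `M`; the lower bound needs the uniform integrability supplied by the moments at `2t`.
-/
lemma lintegral_exp_eq_of_tendsto {ι : Type*} {L : Filter ι} [L.NeBot]
    {ν : ι → ProbabilityMeasure ℝ} {μ : ProbabilityMeasure ℝ} (hν : Tendsto ν L (𝓝 μ))
    {t : ℝ} {a b : ℝ≥0∞} (hb : b ≠ ∞)
    (ha : Tendsto (fun i => ∫⁻ x, ENNReal.ofReal (Real.exp (t * x)) ∂(ν i : Measure ℝ)) L (𝓝 a))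
    (hb' : Tendsto (fun i => ∫⁻ x, ENNReal.ofReal (Real.exp (2 * t * x)) ∂(ν i : Measure ℝ)) L
      (𝓝 b)) :
    ∫⁻ x, ENNReal.ofReal (Real.exp (t * x)) ∂(μ : Measure ℝ) = a := by
  have htr : ∀ M : NNReal, Tendsto (fun i => ∫⁻ x, (truncExp t M x : ℝ≥0∞) ∂(ν i : Measure ℝ)) L
      (𝓝 (∫⁻ x, (truncExp t M x : ℝ≥0∞) ∂(μ : Measure ℝ))) := fun M =>
    (ProbabilityMeasure.tendsto_iff_forall_lintegral_tendsto.1 hν) (truncExp t M)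
  apply le_antisymm
  · have hsup : ∀ x : ℝ, ENNReal.ofReal (Real.exp (t * x)) =
        ⨆ M : ℕ, (truncExp t (M : NNReal) x : ℝ≥0∞) := by
      intro x
      apply le_antisymm
      · obtain ⟨M, hM⟩ := exists_nat_ge (Real.toNNReal (Real.exp (t * x)))
        refine le_iSup_of_le M ?_
        rw [truncExp_apply, min_eq_left hM]
        rfl
      · exact iSup_le fun M => truncExp_le t _ x
    simp_rw [hsup]
    rw [lintegral_iSup]
    · refine iSup_le fun M => le_of_tendsto_of_tendsto (htr M) ha (Eventually.of_forall fun i => ?_)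
      exact lintegral_mono fun x => truncExp_le t _ x
    · intro M
      exact ((truncExp t (M : NNReal)).continuous.measurable).coe_nnreal_ennreal
    · intro M N hMN x
      simp only [truncExp_apply]
      have : (M : NNReal) ≤ N := by exact_mod_cast hMN
      exact_mod_cast min_le_min le_rfl this
  · have key : ∀ M : ℕ, 0 < M → a ≤ ∫⁻ x, ENNReal.ofReal (Real.exp (t * x)) ∂(μ : Measure ℝ)
        + ((M : NNReal) : ℝ≥0∞)⁻¹ * b := by
      intro M hM
      have hM' : (0 : NNReal) < M := by exact_mod_cast hM
      have h1 : a ≤ ∫⁻ x, (truncExp t M x : ℝ≥0∞) ∂(μ : Measure ℝ)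
          + ((M : NNReal) : ℝ≥0∞)⁻¹ * b := by
        refine le_of_tendsto_of_tendsto ha ((htr M).add (ENNReal.Tendsto.const_mul hb' (Or.inr ?_)))
          (Eventually.of_forall fun i => ?_)
        · exact ENNReal.inv_ne_top.2 (by exact_mod_cast hM'.ne')
        · simp only
          rw [← lintegral_const_mul _ (by fun_prop), ← lintegral_add_left
            ((truncExp t (M : NNReal)).continuous.measurable).coe_nnreal_ennreal]
          exact lintegral_mono fun x => exp_le_truncExp_add t hM' x
      exact h1.trans (add_le_add_left (lintegral_mono fun x => truncExp_le t _ x) _)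
    have hlim : Tendsto (fun M : ℕ => ∫⁻ x, ENNReal.ofReal (Real.exp (t * x)) ∂(μ : Measure ℝ)
        + ((M : NNReal) : ℝ≥0∞)⁻¹ * b) atTop
        (𝓝 (∫⁻ x, ENNReal.ofReal (Real.exp (t * x)) ∂(μ : Measure ℝ) + 0 * b)) := by
      refine tendsto_const_nhds.add (ENNReal.Tendsto.mul_const ?_ (Or.inr hb))
      simpa using ENNReal.tendsto_inv_nat_nhds_zero
    rw [zero_mul, add_zero] at hlim
    exact ge_of_tendsto hlim ((eventually_gt_atTop 0).mono key)

/-- A moment generating function finite on the whole line extends to an entire function, determined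
by its real values; its values on the imaginary axis are the characteristic function. -/
lemma eq_gaussianReal_of_lintegral_exp {μ : Measure ℝ} [IsProbabilityMeasure μ]
    (h : ∀ t : ℝ, ∫⁻ x, ENNReal.ofReal (Real.exp (t * x)) ∂μ =
      ENNReal.ofReal (Real.exp (t ^ 2 / 2))) : μ = gaussianReal 0 1 := by
  have hmgf : mgf id μ = mgf id (gaussianReal 0 1) := by
    rw [mgf_id_gaussianReal]
    ext t
    rw [mgf, integral_eq_lintegral_of_nonneg_ae (Eventually.of_forall fun x => (Real.exp_pos _).le)
      (by fun_prop)]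
    simp only [id, h t, ENNReal.toReal_ofReal (Real.exp_pos _).le]
    simp
  have hint : integrableExpSet id μ = Set.univ := by
    ext t
    simp only [integrableExpSet, Set.mem_ofPred_eq, Set.mem_univ, iff_true, id]
    refine ⟨by fun_prop, ?_⟩
    rw [hasFiniteIntegral_iff_ofReal (Eventually.of_forall fun x => (Real.exp_pos _).le), h t]
    exact ENNReal.ofReal_lt_top
  apply Measure.ext_of_complexMGF_id_eq
  ext z
  exact eqOn_complexMGF_of_mgf hmgf (by simp [hint])

lemma tendsto_real_Iic_gaussianReal {ι : Type*} {L : Filter ι}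
    {ν : ι → ProbabilityMeasure ℝ} {μ : ProbabilityMeasure ℝ} (hν : Tendsto ν L (𝓝 μ))
    (hμ : (μ : Measure ℝ) = gaussianReal 0 1) (s : ℝ) :
    Tendsto (fun i => (ν i : Measure ℝ).real (Set.Iic s)) L
      (𝓝 ((gaussianReal 0 1).real (Set.Iic s))) := by
  have h := ProbabilityMeasure.tendsto_measure_of_null_frontier_of_tendsto' hν
    (E := Set.Iic s) (by
      rw [hμ, frontier_Iic]
      have := nullSingletonClass_gaussianReal (μ := 0) (v := 1) one_ne_zero
      exact measure_singleton s)
  rw [hμ] at h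
  exact (ENNReal.tendsto_toReal (measure_ne_top _ _)).comp h

lemma exists_real_Iic_gaussianReal_eq {c : ℝ} (h0 : 0 < c) (h1 : c < 1) :
    ∃ s, (gaussianReal 0 1).real (Set.Iic s) = c := by
  have := nullSingletonClass_gaussianReal (μ := 0) (v := 1) one_ne_zero
  have hc : Continuous (cdf (gaussianReal 0 1)) := by
    rw [continuous_iff_continuousAt]
    intro x
    rw [(monotone_cdf _).continuousAt_iff_leftLim_eq_rightLim]
    rw [StieltjesFunction.rightLim_eq]
    have := (cdf (gaussianReal 0 1)).measure_singleton x
    rw [measure_cdf, measure_singleton] at this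
    have h2 := ENNReal.ofReal_eq_zero.1 this.symm
    exact le_antisymm ((monotone_cdf _).leftLim_le le_rfl) (by linarith)
  obtain ⟨a, ha⟩ := ((tendsto_cdf_atBot (gaussianReal 0 1)).eventually (gt_mem_nhds h0)).exists
  obtain ⟨b, hb⟩ := ((tendsto_cdf_atTop (gaussianReal 0 1)).eventually (lt_mem_nhds h1)).exists
  obtain ⟨s, hs⟩ := mem_range_of_exists_le_of_exists_ge hc ⟨a, ha.le⟩ ⟨b, hb.le⟩
  exact ⟨s, by rw [← cdf_eq_real, hs]⟩

/-- Markov's inequality for eˣ + e⁻ˣ, which is at least e^{|x|}. -/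
lemma isTight_of_lintegral_exp (K : ℝ≥0∞) (hK : K ≠ ∞) :
    IsTightMeasureSet {((μ : ProbabilityMeasure ℝ) : Measure ℝ) | μ ∈
      {ν : ProbabilityMeasure ℝ | ∫⁻ x, ENNReal.ofReal (Real.exp (1 * x)) ∂(ν : Measure ℝ) ≤ K ∧
        ∫⁻ x, ENNReal.ofReal (Real.exp ((-1) * x)) ∂(ν : Measure ℝ) ≤ K}} := by
  apply isTightMeasureSet_of_tendsto_measure_norm_gt
  have hlim : Tendsto (fun r : ℝ => (K + K) / ENNReal.ofReal (Real.exp r)) atTop (𝓝 0) := by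
    have h := ENNReal.Tendsto.const_div (a := K + K)
      (ENNReal.tendsto_ofReal_atTop.comp Real.tendsto_exp_atTop) (Or.inr (by simp [hK]))
    rwa [ENNReal.div_top] at h
  refine tendsto_of_tendsto_of_tendsto_of_le_of_le tendsto_const_nhds hlim
    (fun _ => zero_le) fun r => ?_
  simp only
  refine iSup₂_le ?_
  rintro _ ⟨ν, ⟨h1, h2⟩, rfl⟩
  calc (ν : Measure ℝ) {x | r < ‖x‖}
      ≤ (ν : Measure ℝ) {x | ENNReal.ofReal (Real.exp r) ≤
          ENNReal.ofReal (Real.exp (1 * x)) + ENNReal.ofReal (Real.exp ((-1) * x))} := by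
        refine measure_mono fun x hx => ?_
        rw [Set.mem_ofPred_eq, Real.norm_eq_abs] at hx
        rw [Set.mem_ofPred_eq]
        rcases abs_cases x with ⟨h, _⟩ | ⟨h, _⟩
        · exact le_add_right (ENNReal.ofReal_le_ofReal (Real.exp_le_exp.2 (by linarith)))
        · exact le_add_left (ENNReal.ofReal_le_ofReal (Real.exp_le_exp.2 (by linarith)))
    _ ≤ _ := by
        refine (meas_ge_le_lintegral_div (by fun_prop) (by simp [Real.exp_pos]) (by simp)).trans ?_
        rw [lintegral_add_left (by fun_prop)]
        gcongr

/-- A quantitative continuity theorem for moment generating functions: a probability measure whose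
moment generating function is close to that of `N(0,1)` at finitely many points is close to `N(0,1)`
in Kolmogorov distance. -/
theorem exists_finset_kolmogorov_le {ε : ℝ} (hε : 0 < ε) :
    ∃ F : Finset ℝ, ∃ η : ℝ, 0 < η ∧ ∀ ν : ProbabilityMeasure ℝ,
      (∀ t ∈ F,
        ENNReal.ofReal (Real.exp (t ^ 2 / 2) - η) ≤
          ∫⁻ x, ENNReal.ofReal (Real.exp (t * x)) ∂(ν : Measure ℝ) ∧
        ∫⁻ x, ENNReal.ofReal (Real.exp (t * x)) ∂(ν : Measure ℝ) ≤
          ENNReal.ofReal (Real.exp (t ^ 2 / 2) + η)) →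
      ∀ s, |(ν : Measure ℝ).real (Set.Iic s) - (gaussianReal 0 1).real (Set.Iic s)| ≤ ε := by
  by_contra! hcon
  -- The counterexamples form a net indexed by the finite sets `F` ordered by inclusion: every `t`
  -- eventually lies in `F`, and the tolerance 1/(|F| + 1) tends to 0.
  have hcon' := fun F : Finset ℝ => hcon F (1 / ((F.card : ℝ) + 1)) (by positivity)
  choose ν hν s hs using hcon'
  set η : Finset ℝ → ℝ := fun F => 1 / ((F.card : ℝ) + 1) with hη
  have hcard : Tendsto (fun F : Finset ℝ => F.card) atTop atTop := by
    refine tendsto_atTop.2 fun n => ?_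
    obtain ⟨F, hF⟩ := Infinite.exists_subset_card_eq ℝ n
    filter_upwards [eventually_ge_atTop F] with G hG
    exact hF ▸ Finset.card_le_card hG
  have hη0 : Tendsto η atTop (𝓝 0) :=
    tendsto_one_div_add_atTop_nhds_zero_nat.comp hcard
  have hmgf : ∀ t : ℝ, Tendsto (fun F => ∫⁻ x, ENNReal.ofReal (Real.exp (t * x))
      ∂(ν F : Measure ℝ)) atTop (𝓝 (ENNReal.ofReal (Real.exp (t ^ 2 / 2)))) := by
    intro t
    have hl : Tendsto (fun F => ENNReal.ofReal (Real.exp (t ^ 2 / 2) - η F)) atTop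
        (𝓝 (ENNReal.ofReal (Real.exp (t ^ 2 / 2)))) := by
      simpa using ENNReal.tendsto_ofReal (hη0.const_sub (Real.exp (t ^ 2 / 2)))
    have hu : Tendsto (fun F => ENNReal.ofReal (Real.exp (t ^ 2 / 2) + η F)) atTop
        (𝓝 (ENNReal.ofReal (Real.exp (t ^ 2 / 2)))) := by
      simpa using ENNReal.tendsto_ofReal (hη0.const_add (Real.exp (t ^ 2 / 2)))
    have hmem : ∀ᶠ F : Finset ℝ in atTop, t ∈ F := by
      filter_upwards [eventually_ge_atTop {t}] with G hG
      exact hG (Finset.mem_singleton_self t)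
    exact tendsto_of_tendsto_of_tendsto_of_le_of_le' hl hu
      (hmem.mono fun F hF => (hν F t hF).1) (hmem.mono fun F hF => (hν F t hF).2)
  set K : ℝ≥0∞ := ENNReal.ofReal (Real.exp (1 / 2)) + 1 with hKdef
  have hK : ∀ t : ℝ, t ^ 2 = 1 → ∀ᶠ F in atTop, ∫⁻ x, ENNReal.ofReal (Real.exp (t * x))
      ∂(ν F : Measure ℝ) ≤ K := by
    intro t ht
    refine (hmgf t).eventually_le_const ?_
    rw [ht]
    exact ENNReal.lt_add_right ENNReal.ofReal_ne_top one_ne_zero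
  have hcomp := isCompact_closure_of_isTightMeasureSet (isTight_of_lintegral_exp K (by simp [K]))
  -- This index set has no cofinal sequence, so an ultrafilter takes the place of a convergent
  -- subsequence.
  let U : Ultrafilter (Finset ℝ) := Ultrafilter.of atTop
  have hU : (U : Filter (Finset ℝ)) ≤ atTop := Ultrafilter.of_le _
  obtain ⟨μ, -, hμ⟩ := hcomp.ultrafilter_le_nhds (U.map ν) (by
    rw [Ultrafilter.coe_map, le_principal_iff, mem_map]
    refine hU ?_
    filter_upwards [hK 1 (by norm_num), hK (-1) (by norm_num)] with F h1 h2
    exact subset_closure ⟨h1, h2⟩)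
  have hlim : Tendsto ν (U : Filter (Finset ℝ)) (𝓝 μ) := hμ
  have hμg : (μ : Measure ℝ) = gaussianReal 0 1 :=
    eq_gaussianReal_of_lintegral_exp fun t => lintegral_exp_eq_of_tendsto hlim
      ENNReal.ofReal_ne_top ((hmgf t).mono_left hU) ((hmgf (2 * t)).mono_left hU)
  set G : ℝ → ℝ := fun x => (gaussianReal 0 1).real (Set.Iic x) with hG
  have hGmono : ∀ {x y}, G x < G y → x < y := by
    intro x y h
    by_contra! hxy
    exact absurd (measureReal_mono (μ := gaussianReal 0 1) (Set.Iic_subset_Iic.2 hxy)) (not_le.2 h)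
  have hG01 : ∀ x, G x ∈ Set.Icc (0 : ℝ) 1 := fun x => ⟨measureReal_nonneg, measureReal_le_one⟩
  -- The points `s F` may run off to infinity; their Gaussian probabilities stay in a compact
  -- interval and have a limit `c`.
  obtain ⟨c, ⟨hc0, hc1⟩, hc⟩ := (isCompact_Icc (a := (0 : ℝ)) (b := 1)).ultrafilter_le_nhds
    (U.map fun F => G (s F)) (by
      rw [Ultrafilter.coe_map, le_principal_iff, mem_map]
      exact Eventually.of_forall fun F => hG01 _)
  have hc : Tendsto (fun F => G (s F)) (U : Filter (Finset ℝ)) (𝓝 c) := hc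
  -- Weak convergence applies at a fixed point only, so `s F` is compared by monotonicity with a
  -- fixed Gaussian quantile just above level `c`. No such quantile need exist when c + ε/2 ≥ 1, but
  -- then the bound is trivial.
  have e1 : ∀ᶠ F in (U : Filter (Finset ℝ)), (ν F : Measure ℝ).real (Set.Iic (s F)) ≤ c + ε / 2 := by
    rcases le_or_gt 1 (c + ε / 2) with h | h
    · exact Eventually.of_forall fun F => measureReal_le_one.trans h
    · obtain ⟨r, hr⟩ := exists_real_Iic_gaussianReal_eq (c := c + ε / 4) (by linarith) (by linarith)
      filter_upwards [hc.eventually_lt_const (show c < c + ε / 4 by linarith),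
        (tendsto_real_Iic_gaussianReal hlim hμg r).eventually_lt_const
          (show _ < c + ε / 2 by linarith)] with F h1 h2
      exact (measureReal_mono (Set.Iic_subset_Iic.2 (hGmono (h1.trans_eq hr.symm)).le)).trans h2.le
  have e2 : ∀ᶠ F in (U : Filter (Finset ℝ)), c - ε / 2 ≤ (ν F : Measure ℝ).real (Set.Iic (s F)) := by
    rcases le_or_gt (c - ε / 2) 0 with h | h
    · exact Eventually.of_forall fun F => h.trans measureReal_nonneg
    · obtain ⟨r, hr⟩ := exists_real_Iic_gaussianReal_eq (c := c - ε / 4) (by linarith) (by linarith)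
      filter_upwards [hc.eventually_const_lt (show c - ε / 4 < c by linarith),
        (tendsto_real_Iic_gaussianReal hlim hμg r).eventually_const_lt
          (show c - ε / 2 < _ by linarith)] with F h1 h2
      exact h2.le.trans (measureReal_mono (Set.Iic_subset_Iic.2 (hGmono (hr.trans_lt h1)).le))
  obtain ⟨F, h1, h2, h3, h4⟩ := (e1.and (e2.and ((hc.eventually_lt_const
    (show c < c + ε / 2 by linarith)).and (hc.eventually_const_lt
    (show c - ε / 2 < c by linarith))))).exists
  have := hs F
  rw [lt_abs] at this
  simp only [hG] at h3 h4
  rcases this with h | h <;> linarith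

end LDA

/-! ### Spectral and Frobenius norms -/

namespace LDA

open scoped RealInnerProductSpace

variable {p : ℕ}

/-- A matrix as an operator on Euclidean space. -/
noncomputable abbrev op (A : Mat p) : Vec p →L[ℝ] Vec p :=
  Matrix.toEuclideanCLM (n := Fin p) (𝕜 := ℝ) A

lemma op_apply (A : Mat p) (x : Vec p) (i : Fin p) : op A x i = ∑ j, A i j * x j := by
  rw [op, Matrix.ofLp_toEuclideanCLM]
  rfl

lemma vec_inner (x y : Vec p) : ⟪x, y⟫ = ∑ i, x i * y i := by
  simp [PiLp.inner_apply, mul_comm]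

lemma vec_norm_sq (x : Vec p) : ‖x‖ ^ 2 = ∑ i, x i ^ 2 := by
  simp [EuclideanSpace.norm_sq_eq]

lemma quadForm_eq_inner (A : Mat p) (x : Vec p) : quadForm A x = ⟪x, op A x⟫ := by
  simp only [vec_inner, op_apply, quadForm, Finset.mul_sum, mul_assoc]

lemma inner_op_left (A : Mat p) (x y : Vec p) : ⟪op A x, y⟫ = ⟪x, op Aᵀ y⟫ := by
  simp only [vec_inner, op_apply, Finset.mul_sum, Finset.sum_mul, Matrix.transpose_apply]
  rw [Finset.sum_comm]
  exact Finset.sum_congr rfl fun i _ => Finset.sum_congr rfl fun j _ => by ring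

lemma op_mul_apply (A B : Mat p) (x : Vec p) : op (A * B) x = op A (op B x) := by
  simp [op, map_mul]

lemma specNorm_nonneg (A : Mat p) : 0 ≤ specNorm A := norm_nonneg _

lemma norm_op_le (A : Mat p) (x : Vec p) : ‖op A x‖ ≤ specNorm A * ‖x‖ :=
  (op A).le_opNorm x

lemma specNorm_mul_le (A B : Mat p) : specNorm (A * B) ≤ specNorm A * specNorm B := by
  unfold specNorm
  rw [map_mul]
  exact norm_mul_le _ _

lemma specNorm_add_le (A B : Mat p) : specNorm (A + B) ≤ specNorm A + specNorm B := by
  unfold specNorm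
  rw [map_add]
  exact norm_add_le _ _

lemma specNorm_sub_le (A B : Mat p) : specNorm (A - B) ≤ specNorm A + specNorm B := by
  unfold specNorm
  rw [map_sub]
  exact norm_sub_le _ _

lemma specNorm_neg (A : Mat p) : specNorm (-A) = specNorm A := by
  unfold specNorm
  rw [map_neg, norm_neg]

lemma specNorm_transpose (A : Mat p) : specNorm Aᵀ = specNorm A := by
  unfold specNorm
  rw [← Matrix.conjTranspose_eq_transpose_of_trivial, ← Matrix.star_eq_conjTranspose, map_star,
    ContinuousLinearMap.star_eq_adjoint, LinearIsometryEquiv.norm_map]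

lemma specNorm_mul_self {R : Mat p} (hR : R.IsHermitian) : specNorm (R * R) = specNorm R ^ 2 := by
  unfold specNorm
  rw [map_mul]
  exact IsSelfAdjoint.norm_mul_self (hR.isSelfAdjoint.map _)

lemma frobSq_nonneg (A : Mat p) : 0 ≤ frobSq A :=
  Finset.sum_nonneg fun _ _ => Finset.sum_nonneg fun _ _ => sq_nonneg _

lemma frobSq_transpose (A : Mat p) : frobSq Aᵀ = frobSq A := by
  unfold frobSq
  rw [Finset.sum_comm]
  rfl

lemma frobSq_smul (c : ℝ) (A : Mat p) : frobSq (c • A) = c ^ 2 * frobSq A := by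
  simp only [frobSq, Matrix.smul_apply, smul_eq_mul, mul_pow, Finset.mul_sum]

lemma frobSq_eq_trace (A : Mat p) : frobSq A = (A * Aᵀ).trace := by
  simp [frobSq, Matrix.trace, Matrix.mul_apply, sq]

lemma frobSq_eq_sum_col (A : Mat p) :
    frobSq A = ∑ j, ‖(WithLp.toLp 2 fun i => A i j : Vec p)‖ ^ 2 := by
  simp only [vec_norm_sq, frobSq]
  exact Finset.sum_comm

lemma frobSq_mul_le (A B : Mat p) : frobSq (A * B) ≤ specNorm A ^ 2 * frobSq B := by
  rw [frobSq_eq_sum_col, frobSq_eq_sum_col, Finset.mul_sum]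
  refine Finset.sum_le_sum fun j _ => ?_
  rw [← mul_pow]
  refine pow_le_pow_left₀ (norm_nonneg _) ?_ 2
  have h : (WithLp.toLp 2 fun i => (A * B) i j : Vec p) =
      op A (WithLp.toLp 2 fun i => B i j : Vec p) := by
    ext i
    rw [op_apply]
    rfl
  rw [h]
  exact norm_op_le A _

lemma frobSq_mul_le' (A B : Mat p) : frobSq (A * B) ≤ frobSq A * specNorm B ^ 2 := by
  rw [← frobSq_transpose, Matrix.transpose_mul, mul_comm, ← frobSq_transpose A,
    ← specNorm_transpose B]
  exact frobSq_mul_le _ _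

lemma abs_trace_mul_le (A B : Mat p) : |(A * B).trace| ≤ √(frobSq A) * √(frobSq B) := by
  rw [← Real.sqrt_mul (frobSq_nonneg A)]
  apply Real.abs_le_sqrt
  have h := Finset.sum_mul_sq_le_sq_mul_sq (Finset.univ : Finset (Fin p × Fin p))
    (fun x => A x.1 x.2) (fun x => B x.2 x.1)
  rw [← frobSq_transpose B]
  simpa [Fintype.sum_prod_type, Matrix.trace, Matrix.mul_apply, frobSq] using h

lemma specNorm_sq_le_frobSq (A : Mat p) : specNorm A ^ 2 ≤ frobSq A := by
  have h : specNorm A ≤ √(frobSq A) := by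
    refine ContinuousLinearMap.opNorm_le_bound _ (Real.sqrt_nonneg _) fun x => ?_
    rw [← Real.sqrt_sq (norm_nonneg x), ← Real.sqrt_mul (frobSq_nonneg A)]
    apply Real.le_sqrt_of_sq_le
    change ‖op A x‖ ^ 2 ≤ _
    rw [vec_norm_sq, vec_norm_sq, frobSq, Finset.sum_mul]
    refine Finset.sum_le_sum fun i _ => ?_
    rw [op_apply]
    exact Finset.sum_mul_sq_le_sq_mul_sq _ _ _
  calc specNorm A ^ 2 ≤ √(frobSq A) ^ 2 := pow_le_pow_left₀ (specNorm_nonneg A) h 2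
    _ = frobSq A := Real.sq_sqrt (frobSq_nonneg A)

lemma trace_mul_outer (A : Mat p) (x y : Vec p) : (A * outer x y).trace = ⟪y, op A x⟫ := by
  simp only [Matrix.trace, Matrix.diag, Matrix.mul_apply, outer, Matrix.of_apply, vec_inner,
    op_apply, Finset.mul_sum]
  exact Finset.sum_congr rfl fun i _ => Finset.sum_congr rfl fun j _ => by ring

lemma op_outer (x y w : Vec p) : op (outer x y) w = ⟪y, w⟫ • x := by
  ext i
  simp only [op_apply, outer, Matrix.of_apply, vec_inner, PiLp.smul_apply, smul_eq_mul,
    Finset.sum_mul]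
  exact Finset.sum_congr rfl fun j _ => by ring

lemma transpose_outer (x y : Vec p) : (outer x y)ᵀ = outer y x := by
  ext i j
  simp [outer, mul_comm]

lemma frobSq_outer_self (x : Vec p) : frobSq (outer x x) = (‖x‖ ^ 2) ^ 2 := by
  rw [frobSq_eq_trace, transpose_outer, trace_mul_outer, op_outer, inner_smul_right,
    real_inner_self_eq_norm_sq]
  ring

/-- The right side minus the left side equals (‖a‖² − ‖b‖²)². This inequality is what lets Φ control
the product of the two norms. -/
lemma norm_add_mul_norm_sub_sq_le (a b : Vec p) :
    ‖a + b‖ ^ 2 * ‖a - b‖ ^ 2 ≤ 2 * frobSq (outer a a - outer b b) := by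
  have h : frobSq (outer a a - outer b b) = (‖a‖ ^ 2) ^ 2 + (‖b‖ ^ 2) ^ 2 - 2 * ⟪a, b⟫ ^ 2 := by
    rw [frobSq_eq_trace, Matrix.transpose_sub, transpose_outer, transpose_outer, sub_mul, mul_sub,
      mul_sub]
    simp only [Matrix.trace_sub, trace_mul_outer, op_outer, inner_smul_right,
      real_inner_self_eq_norm_sq, real_inner_comm b a]
    ring
  rw [h, norm_add_sq_real, norm_sub_sq_real]
  nlinarith [sq_nonneg (‖a‖ ^ 2 - ‖b‖ ^ 2)]

/-! ### Square roots of positive definite matrices -/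

section Sqrt

variable {S : Mat p}

lemma sqrt_mul_sqrt (hS : S.PosDef) : CFC.sqrt S * CFC.sqrt S = S :=
  CFC.sqrt_mul_sqrt_self S hS.posSemidef.nonneg

lemma sqrt_isHermitian (S : Mat p) : (CFC.sqrt S).IsHermitian :=
  (CFC.sqrt_nonneg S).isSelfAdjoint

lemma isHermitian_transpose_eq {A : Mat p} (hA : A.IsHermitian) : Aᵀ = A := by
  rw [← Matrix.conjTranspose_eq_transpose_of_trivial]
  exact hA

lemma isUnit_det_sqrt (hS : S.PosDef) : IsUnit (CFC.sqrt S).det := by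
  have h := congrArg Matrix.det (sqrt_mul_sqrt hS)
  rw [Matrix.det_mul] at h
  refine isUnit_iff_ne_zero.2 fun h0 => hS.det_pos.ne' ?_
  rw [← h, h0, mul_zero]

lemma sqrt_inv_mul_sqrt_inv (hS : S.PosDef) : (CFC.sqrt S)⁻¹ * (CFC.sqrt S)⁻¹ = S⁻¹ := by
  rw [← Matrix.mul_inv_rev, sqrt_mul_sqrt hS]

lemma specNorm_sqrt_sq (hS : S.PosDef) : specNorm (CFC.sqrt S) ^ 2 = specNorm S := by
  rw [← specNorm_mul_self (sqrt_isHermitian S), sqrt_mul_sqrt hS]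

lemma specNorm_sqrt_inv_sq (hS : S.PosDef) :
    specNorm (CFC.sqrt S)⁻¹ ^ 2 = specNorm S⁻¹ := by
  rw [← specNorm_mul_self (sqrt_isHermitian S).inv, sqrt_inv_mul_sqrt_inv hS]

lemma norm_sq_le_quadForm_inv (hS : S.PosDef) (x : Vec p) :
    ‖x‖ ^ 2 ≤ specNorm S * quadForm S⁻¹ x := by
  have h1 : quadForm S⁻¹ x = ‖op (CFC.sqrt S)⁻¹ x‖ ^ 2 := by
    rw [quadForm_eq_inner, ← sqrt_inv_mul_sqrt_inv hS, op_mul_apply, ← real_inner_self_eq_norm_sq,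
      inner_op_left, isHermitian_transpose_eq (sqrt_isHermitian S).inv]
  have h2 : x = op (CFC.sqrt S) (op (CFC.sqrt S)⁻¹ x) := by
    rw [← op_mul_apply, Matrix.mul_nonsing_inv _ (isUnit_det_sqrt hS)]
    simp
  rw [h1, ← specNorm_sqrt_sq hS, ← mul_pow]
  refine pow_le_pow_left₀ (norm_nonneg _) ?_ 2
  conv_lhs => rw [h2]
  exact norm_op_le _ _

lemma quadForm_inv_nonneg (hS : S.PosDef) (x : Vec p) : 0 ≤ quadForm S⁻¹ x := by
  have h1 : quadForm S⁻¹ x = ‖op (CFC.sqrt S)⁻¹ x‖ ^ 2 := by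
    rw [quadForm_eq_inner, ← sqrt_inv_mul_sqrt_inv hS, op_mul_apply, ← real_inner_self_eq_norm_sq,
      inner_op_left, isHermitian_transpose_eq (sqrt_isHermitian S).inv]
  rw [h1]
  positivity

/-- Turns the Frobenius term of V² into the trace that the second-order term of log det produces. -/
lemma frobSq_sqrt_mul (hS : S.PosDef) {Ψ : Mat p} (hΨ : Ψ.IsHermitian) :
    frobSq (CFC.sqrt S * Ψ * CFC.sqrt S) = (S * Ψ * S * Ψ).trace := by
  rw [frobSq_eq_trace, Matrix.transpose_mul, Matrix.transpose_mul,
    isHermitian_transpose_eq (sqrt_isHermitian S), isHermitian_transpose_eq hΨ,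
    show CFC.sqrt S * Ψ * CFC.sqrt S * (CFC.sqrt S * (Ψ * CFC.sqrt S))
      = CFC.sqrt S * (Ψ * (CFC.sqrt S * CFC.sqrt S) * Ψ * CFC.sqrt S) by simp only [mul_assoc],
    Matrix.trace_mul_comm, mul_assoc _ (CFC.sqrt S), sqrt_mul_sqrt hS, Matrix.trace_mul_comm]
  simp only [mul_assoc]

lemma frobSq_le_frobSq_sqrt_mul (hS : S.PosDef) (Ψ : Mat p) :
    frobSq Ψ ≤ specNorm S⁻¹ ^ 2 * frobSq (CFC.sqrt S * Ψ * CFC.sqrt S) := by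
  have hu := isUnit_det_sqrt hS
  have h : Ψ = (CFC.sqrt S)⁻¹ * ((CFC.sqrt S * Ψ * CFC.sqrt S) * (CFC.sqrt S)⁻¹) := by
    rw [Matrix.mul_nonsing_inv_cancel_right _ _ hu, Matrix.nonsing_inv_mul_cancel_left _ _ hu]
  calc frobSq Ψ = frobSq ((CFC.sqrt S)⁻¹ * ((CFC.sqrt S * Ψ * CFC.sqrt S) * (CFC.sqrt S)⁻¹)) := by
        rw [← h]
    _ ≤ specNorm (CFC.sqrt S)⁻¹ ^ 2 *
        (frobSq (CFC.sqrt S * Ψ * CFC.sqrt S) * specNorm (CFC.sqrt S)⁻¹ ^ 2) :=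
        (frobSq_mul_le _ _).trans
          (mul_le_mul_of_nonneg_left (frobSq_mul_le' _ _) (sq_nonneg _))
    _ = _ := by rw [specNorm_sqrt_inv_sq hS]; ring

lemma frobSq_sqrt_mul_le (hS : S.PosDef) (Ψ : Mat p) :
    frobSq (CFC.sqrt S * Ψ * CFC.sqrt S) ≤ specNorm S ^ 2 * frobSq Ψ := by
  calc frobSq (CFC.sqrt S * Ψ * CFC.sqrt S)
      ≤ specNorm (CFC.sqrt S) ^ 2 * frobSq Ψ * specNorm (CFC.sqrt S) ^ 2 :=
        (frobSq_mul_le' _ _).trans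
          (mul_le_mul_of_nonneg_right (frobSq_mul_le _ _) (sq_nonneg _))
    _ = _ := by rw [specNorm_sqrt_sq hS]; ring

end Sqrt

/-! ### Second-order expansion of the log determinant -/

section LogDet

lemma abs_log_one_add_sub_le {x : ℝ} (hx : |x| ≤ 1 / 2) :
    |Real.log (1 + x) - x + x ^ 2 / 2| ≤ 2 * |x| ^ 3 := by
  have h := Real.abs_log_sub_add_sum_range_le (x := -x) (by rw [abs_neg]; linarith) 2
  rw [abs_neg] at h
  simp only [Finset.sum_range_succ, Finset.sum_range_zero] at h
  have e : Real.log (1 + x) - x + x ^ 2 / 2 = 0 + (-x) ^ (0 + 1) / ((0 : ℕ) + 1 : ℝ)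
      + (-x) ^ (1 + 1) / ((1 : ℕ) + 1 : ℝ) + Real.log (1 - -x) := by
    rw [sub_neg_eq_add]
    push_cast
    ring
  rw [e]
  refine h.trans ?_
  rw [div_le_iff₀ (by linarith)]
  have : 0 ≤ |x| ^ 3 := by positivity
  norm_num
  nlinarith

lemma det_trace_of_isHermitian {H : Mat p} (hH : H.IsHermitian) :
    (1 + H).det = ∏ i, (1 + hH.eigenvalues i) ∧ H.trace = ∑ i, hH.eigenvalues i ∧
      frobSq H = ∑ i, hH.eigenvalues i ^ 2 := by
  set U := hH.eigenvectorUnitary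
  set D : Mat p := Matrix.diagonal (hH.eigenvalues) with hD
  have hsp : H = Unitary.conjStarAlgAut ℝ (Mat p) U D := hH.spectral_theorem
  have htr : ∀ X : Mat p, (Unitary.conjStarAlgAut ℝ (Mat p) U X).trace = X.trace := by
    intro X
    rw [Unitary.conjStarAlgAut_apply, mul_assoc, Matrix.trace_mul_comm, mul_assoc,
      Unitary.coe_star_mul_self, mul_one]
  have hdet : ∀ X : Mat p, (Unitary.conjStarAlgAut ℝ (Mat p) U X).det = X.det := by
    intro X
    rw [Unitary.conjStarAlgAut_apply, mul_assoc, Matrix.det_mul_comm, mul_assoc,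
      Unitary.coe_star_mul_self, mul_one]
  refine ⟨?_, ?_, ?_⟩
  · have : 1 + H = Unitary.conjStarAlgAut ℝ (Mat p) U (1 + D) := by
      rw [map_add, map_one, ← hsp]
    rw [this, hdet, hD, ← Matrix.diagonal_one, Matrix.diagonal_add, Matrix.det_diagonal]
  · conv_lhs => rw [hsp, htr]
    simp [hD, Matrix.trace_diagonal]
  · rw [frobSq_eq_trace, isHermitian_transpose_eq hH]
    have : H * H = Unitary.conjStarAlgAut ℝ (Mat p) U (D * D) := by
      rw [map_mul, ← hsp]
    rw [this, htr, hD, Matrix.diagonal_mul_diagonal, Matrix.trace_diagonal]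
    simp [sq]

/-- The scalar expansion is summed over the eigenvalues. The cubic errors satisfy ∑|eᵢ|³ ≤ max|eᵢ| ·
∑eᵢ² ≤ ρ³, so the dimension does not enter. -/
lemma abs_log_det_one_add_sub_le {H : Mat p} (hH : H.IsHermitian) {ρ : ℝ} (hρ0 : 0 ≤ ρ)
    (hρ : ρ ≤ 1 / 2) (hle : frobSq H ≤ ρ ^ 2) :
    0 < (1 + H).det ∧
      |Real.log (1 + H).det - H.trace + frobSq H / 2| ≤ 2 * ρ ^ 3 := by
  obtain ⟨h1, h2, h3⟩ := det_trace_of_isHermitian hH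
  set e := hH.eigenvalues
  have he : ∀ i, |e i| ≤ ρ := by
    intro i
    apply abs_le_of_sq_le_sq _ hρ0
    refine le_trans ?_ hle
    rw [h3]
    exact Finset.single_le_sum (f := fun i => e i ^ 2) (fun _ _ => sq_nonneg _) (Finset.mem_univ i)
  have hpos : ∀ i, 0 < 1 + e i := fun i => by
    have := (abs_le.1 (he i)).1
    linarith
  refine ⟨h1 ▸ Finset.prod_pos fun i _ => hpos i, ?_⟩
  rw [h1, Real.log_prod fun i _ => (hpos i).ne', h2, h3, Finset.sum_div, ← Finset.sum_sub_distrib,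
    ← Finset.sum_add_distrib]
  calc |∑ i, (Real.log (1 + e i) - e i + e i ^ 2 / 2)|
      ≤ ∑ i, |Real.log (1 + e i) - e i + e i ^ 2 / 2| := Finset.abs_sum_le_sum_abs _ _
    _ ≤ ∑ i, 2 * ρ * e i ^ 2 := by
        refine Finset.sum_le_sum fun i _ => (abs_log_one_add_sub_le ((he i).trans hρ)).trans ?_
        have : |e i| ^ 3 = |e i| * e i ^ 2 := by rw [← sq_abs]; ring
        rw [this, mul_assoc]
        have := mul_le_mul_of_nonneg_right (he i) (sq_nonneg (e i))
        linarith
    _ = 2 * ρ * frobSq H := by rw [h3, Finset.mul_sum]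
    _ ≤ 2 * ρ * ρ ^ 2 := by gcongr
    _ = _ := by ring

/-- With R the square root of S, det(S⁻¹ + Ψ) = det S⁻¹ · det(1 + RΨR), and RΨR is symmetric, so the
eigenvalue argument applies. -/
lemma abs_log_det_inv_add_sub_le {S Ψ : Mat p} (hS : S.PosDef) (hΨ : Ψ.IsHermitian) {ρ : ℝ}
    (hρ0 : 0 ≤ ρ) (hρ : ρ ≤ 1 / 2) (hle : specNorm S ^ 2 * frobSq Ψ ≤ ρ ^ 2) :
    |Real.log (S⁻¹ + Ψ).det - Real.log S⁻¹.det - (S * Ψ).trace + (S * Ψ * S * Ψ).trace / 2|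
      ≤ 2 * ρ ^ 3 := by
  set R := CFC.sqrt S with hR
  have hRR : R * R = S := sqrt_mul_sqrt hS
  have hH : (R * Ψ * R).IsHermitian := by
    have := Matrix.isHermitian_mul_mul_conjTranspose R hΨ
    rwa [show Rᴴ = R from sqrt_isHermitian S] at this
  obtain ⟨hpos, hb⟩ := abs_log_det_one_add_sub_le hH hρ0 hρ
    ((frobSq_sqrt_mul_le hS Ψ).trans hle)
  have hu : IsUnit S.det := hS.det_pos.ne'.isUnit
  have hdet : (S⁻¹ + Ψ).det = S⁻¹.det * (1 + R * Ψ * R).det := by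
    have : S⁻¹ + Ψ = S⁻¹ * (1 + R * (R * Ψ)) := by
      rw [← mul_assoc, hRR, mul_add, mul_one, Matrix.nonsing_inv_mul_cancel_left _ _ hu]
    rw [this, Matrix.det_mul, Matrix.det_one_add_mul_comm]
  have htr : (R * Ψ * R).trace = (S * Ψ).trace := by
    rw [Matrix.trace_mul_comm, ← mul_assoc, hRR]
  rw [hdet, Real.log_mul hS.inv.det_pos.ne' hpos.ne']
  rw [htr, hR, frobSq_sqrt_mul hS hΨ] at hb
  rw [show ∀ a b c d : ℝ, a + b - a - c + d = b - c + d by intros; ring]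
  exact hb

end LogDet

end LDA

/-! ### Bounds by V and the linearization of Δ -/

namespace LDA

open scoped RealInnerProductSpace

variable {p : ℕ}

namespace Truth

variable (T : Truth p)

lemma prec_isHermitian : T.prec.IsHermitian := T.posDef.inv.isHermitian

lemma isUnit_det_cov : IsUnit T.cov.det := T.posDef.det_pos.ne'.isUnit

lemma Phi_isHermitian : T.Phi.IsHermitian := by
  rw [Matrix.IsHermitian, Matrix.conjTranspose_eq_transpose_of_trivial, Phi]
  simp only [Matrix.transpose_smul, Matrix.transpose_mul, Matrix.transpose_sub, transpose_outer,
    isHermitian_transpose_eq T.prec_isHermitian, mul_assoc]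

lemma V2_nonneg : 0 ≤ T.V2 := by
  have h1 := frobSq_nonneg (CFC.sqrt T.cov * T.Phi * CFC.sqrt T.cov)
  have h2 := quadForm_inv_nonneg T.posDef T.xiX
  have h3 := quadForm_inv_nonneg T.posDef T.xiY
  unfold V2 prec
  linarith

lemma V_nonneg : 0 ≤ T.V := Real.sqrt_nonneg _

lemma V_sq : T.V ^ 2 = T.V2 := Real.sq_sqrt T.V2_nonneg

lemma V_sq_eq_trace : T.V ^ 2 = 4 * (T.cov * T.Phi * T.cov * T.Phi).trace
    + quadForm T.prec T.xiX + quadForm T.prec T.xiY := by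
  rw [V_sq, V2, frobSq_sqrt_mul T.posDef T.Phi_isHermitian]

/-- `C ≥ 1` bounds the spectral norms of `Σ*` and `Ω*`. -/
structure BoundedBy (C : ℝ) : Prop where
  one_le : 1 ≤ C
  cov_le : specNorm T.cov ≤ C
  prec_le : specNorm T.prec ≤ C

variable {T} {C : ℝ}

/-- Each of the three nonnegative pieces of V² is at most V². Hence Φ, ξ_X and ξ_Y are all O(V), and
the factor V⁻¹ in the perturbation cancels them. -/
lemma BoundedBy.sqrt_frobSq_Phi_le (h : T.BoundedBy C) : √(frobSq T.Phi) ≤ C * T.V := by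
  have hC := h.one_le
  apply Real.sqrt_le_iff.2 ⟨mul_nonneg (by linarith) T.V_nonneg, ?_⟩
  have h1 := frobSq_le_frobSq_sqrt_mul T.posDef T.Phi
  have h2 := quadForm_inv_nonneg T.posDef T.xiX
  have h3 := quadForm_inv_nonneg T.posDef T.xiY
  have h4 := frobSq_nonneg (CFC.sqrt T.cov * T.Phi * CFC.sqrt T.cov)
  have h5 : specNorm T.cov⁻¹ ^ 2 ≤ C ^ 2 := pow_le_pow_left₀ (specNorm_nonneg _) h.prec_le 2
  rw [mul_pow, V_sq, V2]
  refine h1.trans (mul_le_mul h5 ?_ h4 (sq_nonneg _))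
  unfold prec
  linarith

lemma BoundedBy.norm_xi_le (h : T.BoundedBy C) {x : Vec p}
    (hx : quadForm T.prec x ≤ T.V2) : ‖x‖ ≤ C * T.V := by
  have hC := h.one_le
  apply le_of_sq_le_sq _ (mul_nonneg (by linarith) T.V_nonneg)
  rw [mul_pow, V_sq]
  calc ‖x‖ ^ 2 ≤ specNorm T.cov * quadForm T.prec x := norm_sq_le_quadForm_inv T.posDef x
    _ ≤ C * T.V2 := mul_le_mul h.cov_le hx (quadForm_inv_nonneg T.posDef x) (by linarith)
    _ ≤ C ^ 2 * T.V2 := by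
        have := T.V2_nonneg
        gcongr
        nlinarith

lemma BoundedBy.norm_xiX_le (h : T.BoundedBy C) : ‖T.xiX‖ ≤ C * T.V := by
  apply h.norm_xi_le
  have h3 := quadForm_inv_nonneg T.posDef T.xiY
  have h4 := frobSq_nonneg (CFC.sqrt T.cov * T.Phi * CFC.sqrt T.cov)
  unfold V2 prec
  linarith

lemma BoundedBy.norm_xiY_le (h : T.BoundedBy C) : ‖T.xiY‖ ≤ C * T.V := by
  apply h.norm_xi_le
  have h3 := quadForm_inv_nonneg T.posDef T.xiX
  have h4 := frobSq_nonneg (CFC.sqrt T.cov * T.Phi * CFC.sqrt T.cov)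
  unfold V2 prec
  linarith

lemma norm_xiX : ‖T.xiX‖ = 2 * ‖T.z - T.muX‖ := by
  simp [xiX, norm_smul]

lemma norm_xiY : ‖T.xiY‖ = 2 * ‖T.z - T.muY‖ := by
  rw [xiY, norm_smul, norm_sub_rev]
  simp

lemma cov_mul_Phi_mul_cov : outer (T.z - T.muX) (T.z - T.muX) - outer (T.z - T.muY) (T.z - T.muY) =
    (2 : ℝ) • (T.cov * T.Phi * T.cov) := by
  have hu := T.isUnit_det_cov
  rw [Phi, Matrix.mul_smul, Matrix.smul_mul, smul_smul, prec, ← mul_assoc, ← mul_assoc,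
    Matrix.mul_nonsing_inv _ hu, one_mul, Matrix.nonsing_inv_mul_cancel_right _ _ hu]
  norm_num

/-- Bounding the two norms separately would give only O(V²). The first power of V comes from ‖aaᵀ −
bbᵀ‖_F = 2‖Σ*ΦΣ*‖_F. -/
lemma BoundedBy.norm_add_mul_norm_sub_le (h : T.BoundedBy C) :
    ‖(T.z - T.muX) + (T.z - T.muY)‖ * ‖(T.z - T.muX) - (T.z - T.muY)‖ ≤ 4 * C ^ 3 * T.V := by
  have hC := h.one_le
  have hC0 : (0 : ℝ) ≤ C := by linarith
  apply le_of_sq_le_sq _ (mul_nonneg (by positivity) T.V_nonneg)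
  rw [mul_pow]
  refine (norm_add_mul_norm_sub_sq_le _ _).trans ?_
  rw [cov_mul_Phi_mul_cov, frobSq_smul]
  have h1 : frobSq (T.cov * T.Phi * T.cov) ≤ C ^ 2 * frobSq T.Phi * C ^ 2 := by
    have hc2 : specNorm T.cov ^ 2 ≤ C ^ 2 := pow_le_pow_left₀ (specNorm_nonneg _) h.cov_le 2
    have hf := frobSq_nonneg T.Phi
    refine (frobSq_mul_le' _ _).trans (mul_le_mul ((frobSq_mul_le _ _).trans ?_) hc2
      (sq_nonneg _) (by positivity))
    gcongr
  have h2 : frobSq T.Phi ≤ C ^ 2 * T.V ^ 2 := by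
    have := pow_le_pow_left₀ (Real.sqrt_nonneg _) h.sqrt_frobSq_Phi_le 2
    rwa [Real.sq_sqrt (frobSq_nonneg _), mul_pow] at this
  calc 2 * (2 ^ 2 * frobSq (T.cov * T.Phi * T.cov))
      ≤ 2 * (2 ^ 2 * (C ^ 2 * (C ^ 2 * T.V ^ 2) * C ^ 2)) := by
        gcongr
        refine h1.trans ?_
        gcongr
    _ ≤ _ := by
        have : 0 ≤ C ^ 6 * T.V ^ 2 := by positivity
        nlinarith

/-- The linearization of the functional `Δ` at the truth. -/
noncomputable def linear (T : Truth p) (u v : Vec p) (E : Mat p) : ℝ :=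
  ⟪T.xiX, op T.prec u⟫ + ⟪T.xiY, op T.prec v⟫ + 2 * (T.Phi * E).trace

end Truth

lemma isUnit_det_add {S E : Mat p} (hS : IsUnit S.det) (h : specNorm S⁻¹ * specNorm E < 1) :
    IsUnit (S + E).det := by
  have h1 : S + E = S * (1 - -(S⁻¹ * E)) := by
    rw [sub_neg_eq_add, mul_add, mul_one, Matrix.mul_nonsing_inv_cancel_left _ _ hS]
  have h2 : IsUnit (1 - -(S⁻¹ * E)) := by
    rw [← isUnit_map_iff (Matrix.toEuclideanCLM (n := Fin p) (𝕜 := ℝ)), map_sub, map_one]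
    apply isUnit_one_sub_of_norm_lt_one
    change specNorm (-(S⁻¹ * E)) < 1
    rw [specNorm_neg]
    exact (specNorm_mul_le _ _).trans_lt h
  rw [h1, Matrix.det_mul]
  exact hS.mul ((Matrix.isUnit_iff_isUnit_det _).1 h2)

section Resolvent

variable {S E : Mat p}

lemma inv_add_sub_inv (hS : IsUnit S.det) (hSE : IsUnit (S + E).det) :
    (S + E)⁻¹ - S⁻¹ = -((S + E)⁻¹ * E * S⁻¹) := by
  have : (S + E)⁻¹ * E = 1 - (S + E)⁻¹ * S := by
    rw [eq_sub_iff_add_eq, ← mul_add, add_comm E, Matrix.nonsing_inv_mul _ hSE]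
  rw [this, sub_mul, one_mul, Matrix.mul_nonsing_inv_cancel_right _ _ hS, neg_sub]

lemma inv_add_sub_inv' (hS : IsUnit S.det) (hSE : IsUnit (S + E).det) :
    (S + E)⁻¹ - S⁻¹ = -(S⁻¹ * E * (S + E)⁻¹) := by
  have : E * (S + E)⁻¹ = 1 - S * (S + E)⁻¹ := by
    rw [eq_sub_iff_add_eq, ← add_mul, add_comm E, Matrix.mul_nonsing_inv _ hSE]
  rw [mul_assoc, this, mul_sub, mul_one, Matrix.nonsing_inv_mul_cancel_left _ _ hS, neg_sub]

/-- The exact remainder is placed symmetrically around (S + E)⁻¹, so that on a vector x it becomes a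
quadratic form in E S⁻¹ x. -/
lemma inv_add_eq (hS : IsUnit S.det) (hSE : IsUnit (S + E).det) :
    (S + E)⁻¹ = S⁻¹ - S⁻¹ * E * S⁻¹ + S⁻¹ * E * (S + E)⁻¹ * E * S⁻¹ := by
  have h1 := inv_add_sub_inv hS hSE
  have h2 := inv_add_sub_inv' hS hSE
  have h3 : S⁻¹ * E * (S + E)⁻¹ * E * S⁻¹ = S⁻¹ * E * ((S + E)⁻¹ * E * S⁻¹) := by
    simp only [mul_assoc]
  rw [h3, show (S + E)⁻¹ * E * S⁻¹ = S⁻¹ - (S + E)⁻¹ by rw [← neg_inj, ← h1]; abel, mul_sub]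
  rw [show S⁻¹ * E * (S + E)⁻¹ = S⁻¹ - (S + E)⁻¹ by rw [← neg_inj, ← h2]; abel]
  abel

lemma specNorm_inv_add_le (hS : IsUnit S.det) {C : ℝ} (hC : specNorm S⁻¹ ≤ C)
    (hE : C * specNorm E ≤ 1 / 2) : IsUnit (S + E).det ∧ specNorm (S + E)⁻¹ ≤ 2 * C := by
  have hlt : specNorm S⁻¹ * specNorm E ≤ 1 / 2 :=
    (mul_le_mul_of_nonneg_right hC (specNorm_nonneg E)).trans hE
  have hSE : IsUnit (S + E).det := isUnit_det_add hS (by linarith)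
  refine ⟨hSE, ?_⟩
  have h1 : (S + E)⁻¹ = S⁻¹ - (S + E)⁻¹ * E * S⁻¹ := by
    rw [sub_eq_add_neg, ← inv_add_sub_inv hS hSE]
    abel
  -- The resolvent identity bounds the norm by C plus half of itself; the half is then absorbed.
  have h2 : specNorm (S + E)⁻¹ ≤ C + specNorm (S + E)⁻¹ * (1 / 2) := by
    calc specNorm (S + E)⁻¹ = specNorm (S⁻¹ - (S + E)⁻¹ * E * S⁻¹) := by rw [← h1]
      _ ≤ specNorm S⁻¹ + specNorm ((S + E)⁻¹ * (E * S⁻¹)) := by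
          rw [← mul_assoc]; exact specNorm_sub_le _ _
      _ ≤ C + specNorm (S + E)⁻¹ * (specNorm E * specNorm S⁻¹) := by
          gcongr
          exact (specNorm_mul_le _ _).trans
            (mul_le_mul_of_nonneg_left (specNorm_mul_le _ _) (specNorm_nonneg _))
      _ ≤ _ := by
          gcongr
          · exact specNorm_nonneg _
          · linarith [mul_comm (specNorm E) (specNorm S⁻¹)]
  linarith

end Resolvent

lemma abs_inner_op_le (A : Mat p) (x y : Vec p) : |⟪x, op A y⟫| ≤ specNorm A * (‖x‖ * ‖y‖) := by
  refine (abs_real_inner_le_norm _ _).trans ?_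
  have := mul_le_mul_of_nonneg_left (norm_op_le A y) (norm_nonneg x)
  linarith

lemma inner_op_symm {A : Mat p} (hA : A.IsHermitian) (x y : Vec p) : ⟪x, op A y⟫ = ⟪y, op A x⟫ := by
  rw [real_inner_comm, inner_op_left, isHermitian_transpose_eq hA]

/-- An exact formula for the remainder. Its last term is the polarization of the difference of the
quadratic forms in EΩ*a and EΩ*b, arranged to involve the product of a + b and a − b. The deviation
E occurs only through its action on Ω*a, Ω*b, Ω*(a + b), Ω*(a − b) and inside the inverse. -/
lemma functional_sub_linear (T : Truth p) {E : Mat p} (hE : E.IsHermitian)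
    (hu : IsUnit (T.cov + E).det) (u v : Vec p) :
    let P' := (T.cov + E)⁻¹
    let a := T.z - T.muX
    let b := T.z - T.muY
    functional T.z (T.muX + u) (T.muY + v) P' - functional T.z T.muX T.muY T.prec
        - T.linear u v E =
      -2 * ⟪u, op P' (op E (op T.prec a))⟫ + 2 * ⟪v, op P' (op E (op T.prec b))⟫
      - ⟪u, op P' u⟫ + ⟪v, op P' v⟫
      - (⟪op E (op T.prec (a + b)), op P' (op E (op T.prec (a - b)))⟫
        + ⟪op E (op T.prec (a - b)), op P' (op E (op T.prec (a + b)))⟫) / 2 := by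
  intro P' a b
  have hP' : P'.IsHermitian := (T.posDef.isHermitian.add hE).inv
  have hP := T.prec_isHermitian
  have e1 : P' = T.prec - T.prec * E * T.prec + T.prec * E * P' * E * T.prec :=
    inv_add_eq T.isUnit_det_cov hu
  have e2 : P' = T.prec - P' * E * T.prec := by
    rw [sub_eq_add_neg, ← sub_eq_iff_eq_add']
    exact inv_add_sub_inv T.isUnit_det_cov hu
  have q1 : ∀ x, ⟪x, op P' x⟫ = ⟪x, op T.prec x⟫ - ⟪x, op T.prec (op E (op T.prec x))⟫
      + ⟪op E (op T.prec x), op P' (op E (op T.prec x))⟫ := by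
    intro x
    have h1 : op P' x = op T.prec x - op T.prec (op E (op T.prec x))
        + op T.prec (op E (op P' (op E (op T.prec x)))) := by
      conv_lhs => rw [e1]
      simp only [op, map_add, map_sub, map_mul, FunLike.coe_add, FunLike.coe_sub,
        Pi.add_apply, Pi.sub_apply]
      rfl
    rw [h1, inner_add_right, inner_sub_right]
    congr 1
    rw [inner_op_left, isHermitian_transpose_eq hE, inner_op_left, isHermitian_transpose_eq hP]
  have q2 : ∀ x w, ⟪w, op P' x⟫ = ⟪w, op T.prec x⟫ - ⟪w, op P' (op E (op T.prec x))⟫ := by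
    intro x w
    have h1 : op P' x = op T.prec x - op P' (op E (op T.prec x)) := by
      conv_lhs => rw [e2]
      simp only [op, map_sub, map_mul]
      rfl
    rw [h1, inner_sub_right]
  have q3 : 2 * (T.Phi * E).trace = ⟪a, op T.prec (op E (op T.prec a))⟫
      - ⟪b, op T.prec (op E (op T.prec b))⟫ := by
    rw [Truth.Phi, Matrix.smul_mul, Matrix.trace_smul, smul_eq_mul, mul_assoc _ T.prec E,
      mul_assoc T.prec, Matrix.trace_mul_comm, mul_assoc, Matrix.trace_mul_comm, mul_sub,
      Matrix.trace_sub, trace_mul_outer, trace_mul_outer, op_mul_apply, op_mul_apply,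
      op_mul_apply, op_mul_apply]
    ring
  rw [Truth.linear, q3, functional, functional]
  simp only [quadForm_eq_inner]
  rw [show T.z - (T.muX + u) = a - u by simp only [a]; abel,
    show T.z - (T.muY + v) = b - v by simp only [b]; abel]
  have hxi : T.xiX = (2 : ℝ) • a := rfl
  have hxi' : T.xiY = -((2 : ℝ) • b) := by
    rw [Truth.xiY, ← smul_neg, neg_sub]
  rw [hxi, hxi', inner_neg_left, inner_smul_left, inner_smul_left]
  rw [show T.z - T.muX = a from rfl, show T.z - T.muY = b from rfl]
  clear_value a b
  have r1 : ⟪a - u, op P' (a - u)⟫ = ⟪a, op P' a⟫ - 2 * ⟪u, op P' a⟫ + ⟪u, op P' u⟫ := by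
    rw [map_sub, inner_sub_right, inner_sub_left, inner_sub_left, inner_op_symm hP' a u]
    ring
  have r2 : ⟪b - v, op P' (b - v)⟫ = ⟪b, op P' b⟫ - 2 * ⟪v, op P' b⟫ + ⟪v, op P' v⟫ := by
    rw [map_sub, inner_sub_right, inner_sub_left, inner_sub_left, inner_op_symm hP' b v]
    ring
  rw [r1, r2, q1 a, q1 b, q2 a u, q2 b v, inner_op_symm hP a u, inner_op_symm hP b v]
  simp only [map_add, map_sub, inner_add_left, inner_add_right, inner_sub_left, inner_sub_right,
    RCLike.conj_to_real]
  ring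

lemma mul_le_of_sq_le {x y τ A B : ℝ} (hA : 0 ≤ A) (hB : 0 ≤ B)
    (hτ : 0 ≤ τ) (h1 : x ^ 2 ≤ τ * A ^ 2) (h2 : y ^ 2 ≤ τ * B ^ 2) : x * y ≤ τ * (A * B) := by
  apply le_of_sq_le_sq _ (by positivity)
  calc (x * y) ^ 2 = x ^ 2 * y ^ 2 := by ring
    _ ≤ (τ * A ^ 2) * (τ * B ^ 2) := by gcongr
    _ = _ := by ring

/-- `τ` controls the squared deviations `u`, `v` of the means and the action of the deviation `E` of
the covariance on the directions that matter for `Δ`. -/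
structure Deviation (T : Truth p) (u v : Vec p) (E : Mat p) (τ : ℝ) : Prop where
  herm : E.IsHermitian
  muX : ‖u‖ ^ 2 ≤ τ
  muY : ‖v‖ ^ 2 ≤ τ
  dirX : ‖op E (op T.prec (T.z - T.muX))‖ ^ 2 ≤ τ * ‖T.z - T.muX‖ ^ 2
  dirY : ‖op E (op T.prec (T.z - T.muY))‖ ^ 2 ≤ τ * ‖T.z - T.muY‖ ^ 2
  dirAdd : ‖op E (op T.prec ((T.z - T.muX) + (T.z - T.muY)))‖ ^ 2
    ≤ τ * ‖(T.z - T.muX) + (T.z - T.muY)‖ ^ 2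
  dirSub : ‖op E (op T.prec ((T.z - T.muX) - (T.z - T.muY)))‖ ^ 2
    ≤ τ * ‖(T.z - T.muX) - (T.z - T.muY)‖ ^ 2

lemma abs_functional_sub_linear_le {T : Truth p} {C : ℝ} (hT : T.BoundedBy C) {u v : Vec p}
    {E : Mat p} {τ : ℝ} (h : Deviation T u v E τ) (hE : C * specNorm E ≤ 1 / 2) :
    |functional T.z (T.muX + u) (T.muY + v) (T.cov + E)⁻¹ - functional T.z T.muX T.muY T.prec
        - T.linear u v E| ≤ τ * (12 * C ^ 4 * T.V + 4 * C) := by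
  obtain ⟨hu, hP'⟩ := specNorm_inv_add_le T.isUnit_det_cov hT.prec_le hE
  rw [functional_sub_linear T h.herm hu]
  have hC := hT.one_le
  have hC0 : 0 ≤ C := by linarith
  have hτ : 0 ≤ τ := (sq_nonneg _).trans h.muX
  have hab := hT.norm_add_mul_norm_sub_le
  have ha := hT.norm_xiX_le
  have hb := hT.norm_xiY_le
  rw [Truth.norm_xiX] at ha
  rw [Truth.norm_xiY] at hb
  set P' := (T.cov + E)⁻¹
  set a := T.z - T.muX
  set b := T.z - T.muY
  have bound : ∀ x y : Vec p, ∀ A B : ℝ, 0 ≤ A → 0 ≤ B → ‖x‖ ^ 2 ≤ τ * A ^ 2 →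
      ‖y‖ ^ 2 ≤ τ * B ^ 2 → |⟪x, op P' y⟫| ≤ 2 * C * (τ * (A * B)) := by
    intro x y A B hA hB hx hy
    refine (abs_inner_op_le P' x y).trans ?_
    exact mul_le_mul hP' (mul_le_of_sq_le hA hB hτ hx hy)
      (by positivity) (by positivity)
  have hu1 : ‖u‖ ^ 2 ≤ τ * 1 ^ 2 := by simpa using h.muX
  have hv1 : ‖v‖ ^ 2 ≤ τ * 1 ^ 2 := by simpa using h.muY
  have b1 := bound u _ 1 ‖a‖ zero_le_one (norm_nonneg _) hu1 h.dirX
  have b2 := bound v _ 1 ‖b‖ zero_le_one (norm_nonneg _) hv1 h.dirY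
  have b3 := bound u u 1 1 zero_le_one zero_le_one hu1 hu1
  have b4 := bound v v 1 1 zero_le_one zero_le_one hv1 hv1
  have b5 := bound _ _ _ _ (norm_nonneg _) (norm_nonneg _) h.dirAdd h.dirSub
  have b6 := bound _ _ _ _ (norm_nonneg _) (norm_nonneg _) h.dirSub h.dirAdd
  rw [one_mul] at b1 b2
  rw [mul_comm ‖a - b‖] at b6
  -- The polarized term contributes 8C⁴V, the two cross terms 2C²V ≤ 2C⁴V each, and the two
  -- quadratic terms in `u`, `v` contribute 2C each, all times τ.
  have c1 : 2 * C * (τ * (‖a + b‖ * ‖a - b‖)) ≤ 2 * C * (τ * (4 * C ^ 3 * T.V)) := by gcongr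
  have c2 : 4 * C * (τ * ‖a‖) ≤ 2 * C * (τ * (C * T.V)) := by
    have : 4 * C * (τ * ‖a‖) = 2 * C * (τ * (2 * ‖a‖)) := by ring
    rw [this]
    gcongr
  have c3 : 4 * C * (τ * ‖b‖) ≤ 2 * C * (τ * (C * T.V)) := by
    have : 4 * C * (τ * ‖b‖) = 2 * C * (τ * (2 * ‖b‖)) := by ring
    rw [this]
    gcongr
  have c4 : τ * T.V * C ^ 2 ≤ τ * T.V * C ^ 4 :=
    mul_le_mul_of_nonneg_left (pow_le_pow_right₀ hC (by norm_num))
      (mul_nonneg hτ T.V_nonneg)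
  rw [abs_le] at *
  constructor <;> linarith

end LDA

/-! ### Local asymptotic normality of the likelihood -/

namespace LDA

open scoped RealInnerProductSpace

variable {n p : ℕ}

lemma scatter_eq_add_outer (hn : n ≠ 0) (x : Fin n → Vec p) (m : Vec p) :
    scatter x m = scatter x (sampleMean x) + outer (sampleMean x - m) (sampleMean x - m) := by
  have hn' : (n : ℝ) ≠ 0 := by exact_mod_cast hn
  ext a b
  have hs : ∀ c, ∑ i, x i c = n * sampleMean x c := by
    intro c
    simp only [sampleMean, PiLp.smul_apply, WithLp.ofLp_sum, Finset.sum_apply, smul_eq_mul]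
    field_simp
  simp only [scatter, outer, Matrix.smul_apply, Matrix.sum_apply, Matrix.of_apply, PiLp.sub_apply,
    Matrix.add_apply, smul_eq_mul]
  have e : ∀ c d : Vec p, ∑ i, (x i a - c a) * (x i b - d b) =
      ∑ i, x i a * x i b - (∑ i, x i a) * d b - c a * (∑ i, x i b) + n * (c a * d b) := by
    intro c d
    rw [Finset.sum_mul, Finset.mul_sum, ← Finset.sum_sub_distrib, ← Finset.sum_sub_distrib]
    have : (n : ℝ) * (c a * d b) = ∑ _i : Fin n, c a * d b := by simp
    rw [this, ← Finset.sum_add_distrib]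
    exact Finset.sum_congr rfl fun i _ => by ring
  rw [e m m, e (sampleMean x) (sampleMean x), hs a, hs b]
  field_simp
  ring

/-- Reduction to the sufficient statistics X̄, Ȳ, Σ̂, the same ones that define the centering Δ̂. -/
lemma logLik_eq (hn : n ≠ 0) (D : Data n p) (θ : Param p) :
    logLik D θ = n * Real.log θ.prec.det - n / 2 * (2 * (θ.prec * pooledCov D).trace
      + quadForm θ.prec (sampleMean D.1 - θ.muX) + quadForm θ.prec (sampleMean D.2 - θ.muY)) := by
  rw [logLik, logLik₁, logLik₁, scatter_eq_add_outer hn D.1, scatter_eq_add_outer hn D.2,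
    Matrix.mul_add, Matrix.mul_add, Matrix.trace_add, Matrix.trace_add, trace_mul_outer, trace_mul_outer,
    ← quadForm_eq_inner, ← quadForm_eq_inner, pooledCov, Matrix.mul_smul, Matrix.trace_smul,
    Matrix.mul_add, Matrix.trace_add, smul_eq_mul]
  ring

lemma quadForm_add_smul {A B : Mat p} (hA : A.IsHermitian) (c g : ℝ) (x y : Vec p) :
    quadForm (A + c • B) (x + g • y) = quadForm A x + 2 * g * ⟪x, op A y⟫ + g ^ 2 * quadForm A y
      + c * quadForm B (x + g • y) := by
  have h : quadForm (A + c • B) (x + g • y) = quadForm A (x + g • y)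
      + c * quadForm B (x + g • y) := by
    simp only [quadForm, Matrix.add_apply, Matrix.smul_apply, smul_eq_mul, Finset.mul_sum,
      ← Finset.sum_add_distrib]
    exact Finset.sum_congr rfl fun i _ => Finset.sum_congr rfl fun j _ => by ring
  rw [h]
  simp only [quadForm_eq_inner, map_add, map_smul, inner_add_left, inner_add_right,
    inner_smul_left, inner_smul_right, RCLike.conj_to_real, inner_op_symm hA y x]
  ring

lemma logLik_perturb_sub (hn : n ≠ 0) (T : Truth p) (t : ℝ) (D : Data n p) {θ : Param p}
    (hθ : θ.prec.IsHermitian) :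
    let g := t / (√(n : ℝ) * T.V)
    let rX := sampleMean D.1 - θ.muX
    let rY := sampleMean D.2 - θ.muY
    logLik D (T.perturb n t θ) - logLik D θ =
      n * (Real.log (θ.prec + (2 * g) • T.Phi).det - Real.log θ.prec.det)
      - n / 2 * (4 * g * (T.Phi * pooledCov D).trace
        + 2 * g * (⟪rX, op θ.prec T.xiX⟫ + ⟪rY, op θ.prec T.xiY⟫)
        + g ^ 2 * (quadForm θ.prec T.xiX + quadForm θ.prec T.xiY)
        + 2 * g * (quadForm T.Phi (rX + g • T.xiX) + quadForm T.Phi (rY + g • T.xiY))) := by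
  intro g rX rY
  have hprec : (T.perturb n t θ).prec = θ.prec + (2 * g) • T.Phi := by
    ext i j
    simp only [Truth.perturb, Param.prec, Matrix.of_apply, Matrix.add_apply, Matrix.smul_apply,
      smul_eq_mul, g]
    ring
  have hX : sampleMean D.1 - (T.perturb n t θ).muX = rX + g • T.xiX := by
    simp only [Truth.perturb, Param.muX, rX, g]
    abel
  have hY : sampleMean D.2 - (T.perturb n t θ).muY = rY + g • T.xiY := by
    simp only [Truth.perturb, Param.muY, rY, g]
    abel
  rw [logLik_eq hn, logLik_eq hn, hprec, hX, hY, quadForm_add_smul hθ, quadForm_add_smul hθ,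
    add_mul, Matrix.trace_add, Matrix.smul_mul, Matrix.trace_smul, smul_eq_mul]
  ring

/-- The standardized functional `√n V⁻¹ (Δ - Δ̂)`. -/
noncomputable def stat (T : Truth p) (D : Data n p) (θ : Param p) : ℝ :=
  √(n : ℝ) * T.V⁻¹ * (functional T.z θ.muX θ.muY θ.prec - centering T.z D)

/-- The data are in the range where the expansion of the likelihood holds. -/
structure GoodData (T : Truth p) (D : Data n p) (κ : ℝ) : Prop where
  dev : Deviation T (sampleMean D.1 - T.muX) (sampleMean D.2 - T.muY) (pooledCov D - T.cov)
    (κ / √(n : ℝ))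
  small : specNorm (pooledCov D - T.cov) ≤ κ

/-- The parameter is in the range where the expansion of the likelihood holds. -/
structure GoodParam (n : ℕ) (T : Truth p) (θ : Param p) (κ : ℝ) : Prop where
  posDef : θ.cov.PosDef
  prec_eq : θ.prec = θ.cov⁻¹
  dev : Deviation T (θ.muX - T.muX) (θ.muY - T.muY) (θ.cov - T.cov) (κ / √(n : ℝ))
  small : specNorm (θ.cov - T.cov) ≤ κ
  small_sq : specNorm (θ.cov - T.cov) ^ 2 ≤ κ / √(n : ℝ)

section Estimates

variable {T : Truth p} {C : ℝ}

/-- Telescoping gives (EΦ)(SΦ) + (Σ*Φ)(EΦ) with E = S − Σ*; Cauchy–Schwarz for the Frobenius inner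
product then bounds the two traces by 2C³ and C³, times ‖E‖V². -/
lemma abs_trace_sub_le (hT : T.BoundedBy C) {S : Mat p} (hS : specNorm S ≤ 2 * C) :
    |(S * T.Phi * S * T.Phi).trace - (T.cov * T.Phi * T.cov * T.Phi).trace| ≤
      3 * C ^ 3 * specNorm (S - T.cov) * T.V ^ 2 := by
  have hC := hT.one_le
  have hV := T.V_nonneg
  set E := S - T.cov
  have e : S * T.Phi * S * T.Phi = T.cov * T.Phi * T.cov * T.Phi
      + ((E * T.Phi) * (S * T.Phi) + (T.cov * T.Phi) * (E * T.Phi)) := by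
    simp only [E, sub_mul, mul_sub, ← mul_assoc]
    abel
  have hsq : ∀ A : Mat p, √(frobSq (A * T.Phi)) ≤ specNorm A * (C * T.V) := by
    intro A
    calc √(frobSq (A * T.Phi)) ≤ √(specNorm A ^ 2 * frobSq T.Phi) :=
          Real.sqrt_le_sqrt (frobSq_mul_le _ _)
      _ = specNorm A * √(frobSq T.Phi) := by
          rw [Real.sqrt_mul (sq_nonneg _), Real.sqrt_sq (specNorm_nonneg A)]
      _ ≤ _ := mul_le_mul_of_nonneg_left hT.sqrt_frobSq_Phi_le (specNorm_nonneg A)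
  have hE := specNorm_nonneg E
  have b1 := (abs_trace_mul_le (E * T.Phi) (S * T.Phi)).trans
    (mul_le_mul (hsq E) ((hsq S).trans (mul_le_mul_of_nonneg_right hS (by positivity)))
      (Real.sqrt_nonneg _) (by positivity))
  have b2 := (abs_trace_mul_le (T.cov * T.Phi) (E * T.Phi)).trans
    (mul_le_mul ((hsq T.cov).trans (mul_le_mul_of_nonneg_right hT.cov_le (by positivity)))
      (hsq E) (Real.sqrt_nonneg _) (by positivity))
  rw [e, Matrix.trace_add, Matrix.trace_add, add_sub_cancel_left]
  refine (abs_add_le _ _).trans ((add_le_add b1 b2).trans (le_of_eq ?_))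
  ring

lemma abs_quadForm_le (A : Mat p) (x : Vec p) : |quadForm A x| ≤ specNorm A * ‖x‖ ^ 2 := by
  rw [quadForm_eq_inner, sq]
  exact abs_inner_op_le A x x

lemma quadForm_sub (A B : Mat p) (x : Vec p) :
    quadForm (A - B) x = quadForm A x - quadForm B x := by
  simp only [quadForm_eq_inner, op, map_sub, ← inner_sub_right]
  rfl

lemma inner_op_sub (A B : Mat p) (x y : Vec p) :
    ⟪x, op (A - B) y⟫ = ⟪x, op A y⟫ - ⟪x, op B y⟫ := by
  simp only [op, map_sub, ← inner_sub_right]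
  rfl

lemma norm_sub_sq_le {u v : Vec p} {τ : ℝ} (hu : ‖u‖ ^ 2 ≤ τ) (hv : ‖v‖ ^ 2 ≤ τ) :
    ‖v - u‖ ^ 2 ≤ 4 * τ := by
  have := pow_le_pow_left₀ (norm_nonneg _) (norm_sub_le v u) 2
  nlinarith [sq_nonneg (‖v‖ - ‖u‖)]

lemma norm_add_smul_sq_le (r x : Vec p) (g : ℝ) :
    ‖r + g • x‖ ^ 2 ≤ 2 * ‖r‖ ^ 2 + 2 * (g ^ 2 * ‖x‖ ^ 2) := by
  have h := pow_le_pow_left₀ (norm_nonneg _) (norm_add_le r (g • x)) 2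
  have h2 : ‖g • x‖ ^ 2 = g ^ 2 * ‖x‖ ^ 2 := by
    rw [norm_smul, mul_pow, Real.norm_eq_abs, sq_abs]
  nlinarith [sq_nonneg (‖r‖ - ‖g • x‖)]

lemma specNorm_Phi_le (hT : T.BoundedBy C) : specNorm T.Phi ≤ C * T.V :=
  (Real.le_sqrt_of_sq_le (specNorm_sq_le_frobSq _)).trans hT.sqrt_frobSq_Phi_le

set_option maxHeartbeats 2000000 in
/-- Local asymptotic normality: the likelihood ratio of the perturbed parameter. -/
theorem abs_logLik_perturb_sub_le (hn : n ≠ 0) (hT : T.BoundedBy C) (hV : 0 < T.V)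
    (hVC : T.V⁻¹ ≤ C) {D : Data n p} {θ : Param p} {κ : ℝ} (hD : GoodData T D κ)
    (hθ : GoodParam n T θ κ) (t : ℝ) (hκ0 : 1 / √(n : ℝ) ≤ κ) (hκ1 : C * κ ≤ 1 / 2)
    (hκt : 4 * |t| * C ^ 2 * κ ≤ 1 / 2) :
    |logLik D (T.perturb n t θ) - logLik D θ - (t * stat T D θ - t ^ 2 / 2)| ≤
      (128 * |t| ^ 3 * C ^ 6 + 8 * C ^ 3 * |t| + 6 * t ^ 2 * C ^ 3 + 2 * C ^ 4 * t ^ 2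
        + (16 * |t| * C + 4 * |t| ^ 3 * C ^ 3) + |t| * (24 * C ^ 4 + 8 * C ^ 2)) * κ := by
  have hC := hT.one_le
  have hC0 : 0 < C := by linarith
  set N := √(n : ℝ) with hN
  have hnpos : 0 < (n : ℝ) := by exact_mod_cast Nat.pos_of_ne_zero hn
  have hNpos : 0 < N := Real.sqrt_pos.2 hnpos
  have hNsq : (n : ℝ) = N ^ 2 := (Real.sq_sqrt hnpos.le).symm
  have hκpos : 0 < κ := lt_of_lt_of_le (by positivity) hκ0
  set V := T.V with hVdef
  set w := V⁻¹ with hw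
  have hwpos : 0 < w := inv_pos.2 hV
  have hwV : w * V = 1 := inv_mul_cancel₀ hV.ne'
  set E := θ.cov - T.cov with hE
  set Eh := pooledCov D - T.cov with hEh
  set u := θ.muX - T.muX with hu
  set v := θ.muY - T.muY with hv
  set uh := sampleMean D.1 - T.muX with huh
  set vh := sampleMean D.2 - T.muY with hvh
  set e := specNorm E with he
  have he0 : 0 ≤ e := specNorm_nonneg E
  have heκ : C * e ≤ 1 / 2 := (mul_le_mul_of_nonneg_left hθ.small hC0.le).trans hκ1
  have hcovE : T.cov + E = θ.cov := by rw [hE]; abel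
  have hcovEh : T.cov + Eh = pooledCov D := by rw [hEh]; abel
  obtain ⟨hunit, hP'⟩ := specNorm_inv_add_le T.isUnit_det_cov hT.prec_le heκ
  -- expansions of the functional
  have R1 := abs_functional_sub_linear_le hT hθ.dev heκ
  have R2 := abs_functional_sub_linear_le hT hD.dev
    ((mul_le_mul_of_nonneg_left hD.small hC0.le).trans hκ1)
  rw [hcovE, ← hθ.prec_eq, show T.muX + u = θ.muX by rw [hu]; abel,
    show T.muY + v = θ.muY by rw [hv]; abel] at R1
  rw [hcovEh, show T.muX + uh = sampleMean D.1 by rw [huh]; abel,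
    show T.muY + vh = sampleMean D.2 by rw [hvh]; abel] at R2
  change |centering T.z D - _ - _| ≤ _ at R2
  set Δ₀ := functional T.z T.muX T.muY T.prec
  set r1 := functional T.z θ.muX θ.muY θ.prec - Δ₀ - T.linear u v E with hr1
  set r2 := centering T.z D - Δ₀ - T.linear uh vh Eh with hr2
  -- notation for the expansion of the likelihood
  have hprecH : θ.prec.IsHermitian := hθ.prec_eq ▸ hθ.posDef.inv.isHermitian
  have hexp := logLik_perturb_sub hn T t D hprecH
  set g := t / (N * V) with hg
  have hgw : g = t * w / N := by rw [hg, hw]; field_simp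
  set rX := sampleMean D.1 - θ.muX with hrX
  set rY := sampleMean D.2 - θ.muY with hrY
  have hrX' : rX = uh - u := by rw [hrX, huh, hu]; abel
  have hrY' : rY = vh - v := by rw [hrY, hvh, hv]; abel
  set τ := κ / N with hτ
  have hτ0 : 0 ≤ τ := by positivity
  have hNτ : N * τ = κ := by rw [hτ]; field_simp
  have hrXn : ‖rX‖ ^ 2 ≤ 4 * τ := hrX' ▸ norm_sub_sq_le hθ.dev.muX hD.dev.muX
  have hrYn : ‖rY‖ ^ 2 ≤ 4 * τ := hrY' ▸ norm_sub_sq_le hθ.dev.muY hD.dev.muY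
  have hxiX := hT.norm_xiX_le
  have hxiY := hT.norm_xiY_le
  rw [← hVdef] at hxiX hxiY
  set Δp := θ.prec - T.prec with hΔp
  have hΔpn : specNorm Δp ≤ 2 * C ^ 2 * e := by
    have h1 : Δp = -((T.cov + E)⁻¹ * E * T.prec) := by
      rw [hΔp, hθ.prec_eq, ← hcovE]
      exact inv_add_sub_inv T.isUnit_det_cov hunit
    rw [h1, specNorm_neg]
    calc specNorm ((T.cov + E)⁻¹ * E * T.prec)
        ≤ specNorm (T.cov + E)⁻¹ * specNorm E * specNorm T.prec :=
          (specNorm_mul_le _ _).trans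
            (mul_le_mul_of_nonneg_right (specNorm_mul_le _ _) (specNorm_nonneg _))
      _ ≤ 2 * C * e * C := by
          gcongr
          · exact specNorm_nonneg _
          · exact hT.prec_le
      _ = _ := by ring
  have hcov2 : specNorm θ.cov ≤ 2 * C := by
    rw [← hcovE]
    refine (specNorm_add_le _ _).trans ?_
    have : e ≤ C := by nlinarith
    linarith [hT.cov_le]
  -- the six error terms
  set ld := Real.log (θ.prec + (2 * g) • T.Phi).det - Real.log θ.prec.det with hld
  set tA := n * (ld - 2 * g * (θ.cov * T.Phi).trace
    + 2 * g ^ 2 * (θ.cov * T.Phi * θ.cov * T.Phi).trace) with htA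
  set tB := ⟪rX, op Δp T.xiX⟫ + ⟪rY, op Δp T.xiY⟫ with htB
  set tC := (θ.cov * T.Phi * θ.cov * T.Phi).trace - (T.cov * T.Phi * T.cov * T.Phi).trace with htC
  set tQ := quadForm Δp T.xiX + quadForm Δp T.xiY with htQ
  set tF := quadForm T.Phi (rX + g • T.xiX) + quadForm T.Phi (rY + g • T.xiY) with htF
  have hng : n * g = N * t * w := by rw [hgw, hNsq]; field_simp
  have hng2 : n * g ^ 2 = t ^ 2 * w ^ 2 := by rw [hgw, hNsq]; field_simp
  -- An exact identity. `tA` is the cubic remainder of log det; `tB`, `tC`, `tQ` come from replacing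
  -- Ω and Σ by Ω* and Σ*; `tF` is Φ evaluated at the shifted mean deviations; `r1`, `r2` are the
  -- linearization remainders of Δ and Δ̂. The first-order terms cancel against the linear part of t
  -- W.
  have hident : logLik D (T.perturb n t θ) - logLik D θ - (t * stat T D θ - t ^ 2 / 2) =
      tA - N * t * w * tB - 2 * (t ^ 2 * w ^ 2) * tC - t ^ 2 * w ^ 2 / 2 * tQ
        - N * t * w * tF - t * N * w * (r1 - r2) := by
    have hstat : stat T D θ = N * w * (T.linear u v E - T.linear uh vh Eh + r1 - r2) := by
      rw [stat, hr1, hr2]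
      ring
    have hlin : T.linear u v E - T.linear uh vh Eh = -⟪rX, op T.prec T.xiX⟫ - ⟪rY, op T.prec T.xiY⟫
        + 2 * (θ.cov * T.Phi).trace - 2 * (T.Phi * pooledCov D).trace := by
      have e1 : ⟪rX, op T.prec T.xiX⟫ = ⟪T.xiX, op T.prec uh⟫ - ⟪T.xiX, op T.prec u⟫ := by
        rw [inner_op_symm T.prec_isHermitian rX, hrX', map_sub (op T.prec) uh u, inner_sub_right]
      have e2 : ⟪rY, op T.prec T.xiY⟫ = ⟪T.xiY, op T.prec vh⟫ - ⟪T.xiY, op T.prec v⟫ := by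
        rw [inner_op_symm T.prec_isHermitian rY, hrY', map_sub (op T.prec) vh v, inner_sub_right]
      rw [Truth.linear, Truth.linear, e1, e2, hE, hEh, mul_sub, mul_sub, Matrix.trace_sub, Matrix.trace_sub,
        Matrix.trace_mul_comm T.Phi θ.cov]
      ring
    -- The second-order terms of the log determinant and of the mean part, taken at the truth, add
    -- up to −t²/2 by the definition of V².
    have hV2 : t ^ 2 = t ^ 2 * w ^ 2 * (4 * (T.cov * T.Phi * T.cov * T.Phi).trace
        + quadForm T.prec T.xiX + quadForm T.prec T.xiY) := by
      rw [← T.V_sq_eq_trace, ← hVdef, mul_assoc, ← mul_pow, hwV]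
      ring
    have hB : ⟪rX, op θ.prec T.xiX⟫ + ⟪rY, op θ.prec T.xiY⟫ =
        tB + ⟪rX, op T.prec T.xiX⟫ + ⟪rY, op T.prec T.xiY⟫ := by
      rw [htB, hΔp, inner_op_sub, inner_op_sub]
      ring
    have hQ : quadForm θ.prec T.xiX + quadForm θ.prec T.xiY =
        tQ + quadForm T.prec T.xiX + quadForm T.prec T.xiY := by
      rw [htQ, hΔp, quadForm_sub, quadForm_sub]
      ring
    rw [hexp, hstat, hlin, hB, hQ, htA, htC, ← hng2, show t * N * w = n * g by rw [hng]; ring]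
    rw [show t * (N * w * (-⟪rX, op T.prec T.xiX⟫ - ⟪rY, op T.prec T.xiY⟫
        + 2 * (θ.cov * T.Phi).trace - 2 * (T.Phi * pooledCov D).trace + r1 - r2)) =
        n * g * (-⟪rX, op T.prec T.xiX⟫ - ⟪rY, op T.prec T.xiY⟫
        + 2 * (θ.cov * T.Phi).trace - 2 * (T.Phi * pooledCov D).trace + r1 - r2) by
        rw [hng]; ring, ← hng]
    rw [← hng2] at hV2
    rw [show ∀ a b : ℝ, a - (b - t ^ 2 / 2) = a - b + t ^ 2 / 2 by intros; ring]
    rw [hV2]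
    ring
  have bA : |tA| ≤ 128 * |t| ^ 3 * C ^ 6 * κ := by
    -- This ρ is the product of ‖Σ‖ ≤ 2C and ‖2gΦ‖_F ≤ 2|t|C/√n. The error n · 2ρ³ is then of order
    -- n^{-1/2}.
    have hρ : 4 * |t| * C ^ 2 / N ≤ 1 / 2 := by
      refine le_trans ?_ hκt
      rw [div_eq_mul_one_div]
      gcongr
    have hle : specNorm θ.cov ^ 2 * frobSq ((2 * g) • T.Phi) ≤ (4 * |t| * C ^ 2 / N) ^ 2 := by
      rw [frobSq_smul]
      have h1 : frobSq T.Phi ≤ (C * V) ^ 2 := by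
        rw [← Real.sq_sqrt (frobSq_nonneg T.Phi)]
        exact pow_le_pow_left₀ (Real.sqrt_nonneg _) hT.sqrt_frobSq_Phi_le 2
      calc specNorm θ.cov ^ 2 * ((2 * g) ^ 2 * frobSq T.Phi)
          ≤ (2 * C) ^ 2 * ((2 * g) ^ 2 * (C * V) ^ 2) := by
            have := specNorm_nonneg θ.cov
            have := frobSq_nonneg T.Phi
            gcongr
        _ = (4 * |t| * C ^ 2 / N) ^ 2 * (w * V) ^ 2 := by
            rw [hgw]
            simp only [div_pow, mul_pow, sq_abs]
            ring
        _ = _ := by rw [hwV]; ring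
    have hmain := abs_log_det_inv_add_sub_le hθ.posDef
      (Ψ := (2 * g) • T.Phi) (T.Phi_isHermitian.smul (k := 2 * g) rfl) (by positivity) hρ hle
    rw [← hθ.prec_eq] at hmain
    have htA' : tA = n * (Real.log (θ.prec + (2 * g) • T.Phi).det - Real.log θ.prec.det
        - (θ.cov * (2 * g) • T.Phi).trace
        + (θ.cov * (2 * g) • T.Phi * θ.cov * (2 * g) • T.Phi).trace / 2) := by
      rw [htA, hld]
      simp only [Matrix.mul_smul, Matrix.smul_mul, Matrix.trace_smul, smul_eq_mul]
      ring
    rw [htA', abs_mul, abs_of_pos hnpos]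
    calc _ ≤ n * (2 * (4 * |t| * C ^ 2 / N) ^ 3) := mul_le_mul_of_nonneg_left hmain hnpos.le
      _ = 128 * |t| ^ 3 * C ^ 6 * (1 / N) := by
          rw [hNsq]
          field_simp
          ring
      _ ≤ _ := by gcongr
  -- Only the covariance deviation of the parameter is multiplied by a mean deviation here, and its
  -- full spectral norm squared is at most κ/√n; the factor √n is thus absorbed by two factors of
  -- order √τ.
  have hNer : ∀ r : Vec p, ‖r‖ ^ 2 ≤ 4 * τ → N * (e * ‖r‖) ≤ 2 * κ := by
    intro r hr
    have : e * ‖r‖ ≤ 2 * τ := by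
      apply le_of_sq_le_sq _ (by positivity)
      calc (e * ‖r‖) ^ 2 = e ^ 2 * ‖r‖ ^ 2 := by ring
        _ ≤ τ * (4 * τ) := by
          have := hθ.small_sq
          gcongr
        _ = _ := by ring
    calc N * (e * ‖r‖) ≤ N * (2 * τ) := by gcongr
      _ = 2 * κ := by rw [← hNτ]; ring
  have hwx : ∀ x : Vec p, ‖x‖ ≤ C * V → w * ‖x‖ ≤ C := by
    intro x hx
    calc w * ‖x‖ ≤ w * (C * V) := by gcongr
      _ = C * (w * V) := by ring
      _ = C := by rw [hwV, mul_one]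
  have bB : |N * t * w * tB| ≤ 8 * C ^ 3 * |t| * κ := by
    have one : ∀ r x : Vec p, ‖r‖ ^ 2 ≤ 4 * τ → ‖x‖ ≤ C * V →
        N * |t| * w * |⟪r, op Δp x⟫| ≤ 4 * C ^ 3 * |t| * κ := by
      intro r x hr hx
      calc N * |t| * w * |⟪r, op Δp x⟫| ≤ N * |t| * w * ((2 * C ^ 2 * e) * (‖r‖ * ‖x‖)) := by
            gcongr
            exact (abs_inner_op_le _ _ _).trans (by gcongr)
        _ = 2 * C ^ 2 * |t| * (N * (e * ‖r‖)) * (w * ‖x‖) := by ring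
        _ ≤ 2 * C ^ 2 * |t| * (2 * κ) * C :=
            mul_le_mul (mul_le_mul_of_nonneg_left (hNer r hr) (by positivity)) (hwx x hx)
              (by positivity) (by positivity)
        _ = _ := by ring
    have h1 := one rX _ hrXn hxiX
    have h2 := one rY _ hrYn hxiY
    rw [abs_mul, abs_mul, abs_mul, abs_of_pos hNpos, abs_of_pos hwpos]
    calc N * |t| * w * |tB| ≤ N * |t| * w * (|⟪rX, op Δp T.xiX⟫| + |⟪rY, op Δp T.xiY⟫|) := by
          gcongr
          exact abs_add_le _ _
      _ ≤ _ := by linarith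
  have bC : |2 * (t ^ 2 * w ^ 2) * tC| ≤ 6 * t ^ 2 * C ^ 3 * κ := by
    rw [abs_mul, abs_of_nonneg (by positivity)]
    calc 2 * (t ^ 2 * w ^ 2) * |tC| ≤ 2 * (t ^ 2 * w ^ 2) * (3 * C ^ 3 * e * V ^ 2) := by
          gcongr
          exact abs_trace_sub_le hT hcov2
      _ = 6 * t ^ 2 * C ^ 3 * e * (w * V) ^ 2 := by ring
      _ ≤ _ := by
          rw [hwV, one_pow, mul_one]
          have := hθ.small
          gcongr
  have bQ : |t ^ 2 * w ^ 2 / 2 * tQ| ≤ 2 * C ^ 4 * t ^ 2 * κ := by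
    have one : ∀ x : Vec p, ‖x‖ ≤ C * V → w ^ 2 * |quadForm Δp x| ≤ 2 * C ^ 4 * κ := by
      intro x hx
      calc w ^ 2 * |quadForm Δp x| ≤ w ^ 2 * (2 * C ^ 2 * e * ‖x‖ ^ 2) := by
            gcongr
            exact (abs_quadForm_le _ _).trans (by gcongr)
        _ = 2 * C ^ 2 * e * (w * ‖x‖) ^ 2 := by ring
        _ ≤ 2 * C ^ 2 * κ * C ^ 2 := by
            gcongr
            · exact hθ.small
            · exact hwx x hx
        _ = _ := by ring
    have h1 := one _ hxiX
    have h2 := one _ hxiY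
    rw [abs_mul, abs_of_nonneg (by positivity)]
    calc t ^ 2 * w ^ 2 / 2 * |tQ|
        ≤ t ^ 2 * w ^ 2 / 2 * (|quadForm Δp T.xiX| + |quadForm Δp T.xiY|) := by
          gcongr
          exact abs_add_le _ _
      _ = t ^ 2 / 2 * (w ^ 2 * |quadForm Δp T.xiX| + w ^ 2 * |quadForm Δp T.xiY|) := by ring
      _ ≤ t ^ 2 / 2 * (2 * C ^ 4 * κ + 2 * C ^ 4 * κ) := by gcongr
      _ = _ := by ring
  have bF : |N * t * w * tF| ≤ (16 * |t| * C + 4 * |t| ^ 3 * C ^ 3) * κ := by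
    have one : ∀ r x : Vec p, ‖r‖ ^ 2 ≤ 4 * τ → ‖x‖ ≤ C * V →
        N * |t| * w * |quadForm T.Phi (r + g • x)| ≤ (8 * |t| * C + 2 * |t| ^ 3 * C ^ 3) * κ := by
      intro r x hr hx
      have h1 : g ^ 2 * ‖x‖ ^ 2 ≤ t ^ 2 * C ^ 2 / N ^ 2 := by
        have : g ^ 2 * ‖x‖ ^ 2 = t ^ 2 * (w * ‖x‖) ^ 2 / N ^ 2 := by
          rw [hgw]
          field_simp
        rw [this]
        gcongr
        exact hwx x hx
      have h2 : ‖r + g • x‖ ^ 2 ≤ 8 * τ + 2 * (t ^ 2 * C ^ 2 / N ^ 2) := by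
        refine (norm_add_smul_sq_le r x g).trans ?_
        linarith
      calc N * |t| * w * |quadForm T.Phi (r + g • x)|
          ≤ N * |t| * w * ((C * V) * (8 * τ + 2 * (t ^ 2 * C ^ 2 / N ^ 2))) := by
            gcongr
            exact (abs_quadForm_le _ _).trans
              (mul_le_mul (specNorm_Phi_le hT) h2 (sq_nonneg _) (by positivity))
        _ = |t| * C * (w * V) * (8 * (N * τ) + 2 * t ^ 2 * C ^ 2 * (1 / N)) := by
            field_simp
        _ ≤ |t| * C * (8 * κ + 2 * t ^ 2 * C ^ 2 * κ) := by
            rw [hwV, mul_one, hNτ]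
            gcongr
        _ = _ := by
            rw [← sq_abs t]
            ring
    have h1 := one rX _ hrXn hxiX
    have h2 := one rY _ hrYn hxiY
    rw [abs_mul, abs_mul, abs_mul, abs_of_pos hNpos, abs_of_pos hwpos]
    calc N * |t| * w * |tF| ≤ N * |t| * w * (|quadForm T.Phi (rX + g • T.xiX)|
          + |quadForm T.Phi (rY + g • T.xiY)|) := by
          gcongr
          exact abs_add_le _ _
      _ ≤ _ := by linarith
  have bR : |t * N * w * (r1 - r2)| ≤ |t| * (24 * C ^ 4 + 8 * C ^ 2) * κ := by
    rw [abs_mul, abs_mul, abs_mul, abs_of_pos hNpos, abs_of_pos hwpos]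
    calc |t| * N * w * |r1 - r2|
        ≤ |t| * N * w * (τ * (12 * C ^ 4 * V + 4 * C) + τ * (12 * C ^ 4 * V + 4 * C)) := by
          gcongr
          exact (abs_sub _ _).trans (add_le_add R1 R2)
      _ = |t| * (N * τ) * (24 * C ^ 4 * (w * V) + 8 * C * w) := by ring
      _ ≤ |t| * κ * (24 * C ^ 4 + 8 * C * C) := by
          rw [hwV, mul_one, hNτ]
          gcongr
      _ = _ := by ring
  rw [hident]
  rw [abs_le] at *
  constructor <;> linarith

end Estimates

end LDA

/-! ### Gaussian moments and concentration of the sample mean and covariance -/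

namespace LDA

open scoped RealInnerProductSpace

section GaussianMoments

/-- The fourth moment of the standard Gaussian distribution. -/
noncomputable def gaussianFourthMoment : ℝ := ∫ x, x ^ 4 ∂(gaussianReal 0 1)

lemma gaussianFourthMoment_nonneg : 0 ≤ gaussianFourthMoment :=
  integral_nonneg fun x => by positivity

lemma integral_pow_four_gaussianReal (v : NNReal) :
    ∫ x, x ^ 4 ∂(gaussianReal 0 v) = (v : ℝ) ^ 2 * gaussianFourthMoment := by
  have h := gaussianReal_map_const_mul (μ := 0) (v := 1) (√(v : ℝ))
  have hv : NNReal.mk (√(v : ℝ) ^ 2) (sq_nonneg _) * 1 = v := by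
    rw [mul_one]
    ext
    exact Real.sq_sqrt v.coe_nonneg
  rw [mul_zero, hv] at h
  rw [← h, integral_map (by fun_prop) (by fun_prop), gaussianFourthMoment, ← integral_const_mul]
  refine integral_congr_ae (Eventually.of_forall fun x => ?_)
  have : √(v : ℝ) ^ 4 = (v : ℝ) ^ 2 := by
    rw [show 4 = 2 * 2 by rfl, pow_mul, Real.sq_sqrt v.coe_nonneg]
  simp only [mul_pow, this]

variable {p : ℕ} {m : Vec p} {S : Mat p}

lemma integral_inner_sub (w : Vec p) :
    ∫ x, ⟪x - m, w⟫ ∂(multivariateGaussian m S) = 0 := by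
  have h : ∀ x, ⟪x - m, w⟫ = innerSL ℝ w x - ⟪w, m⟫ := fun x => by
    rw [inner_sub_left, innerSL_apply_apply, real_inner_comm, real_inner_comm m]
  simp_rw [h]
  rw [integral_sub (ContinuousLinearMap.integrable_comp _ IsGaussian.integrable_fun_id)
    (integrable_const _), ContinuousLinearMap.integral_comp_comm _ IsGaussian.integrable_fun_id]
  simp

lemma map_inner_sub (hS : S.PosDef) (w : Vec p) :
    (multivariateGaussian m S).map (fun x => ⟪x - m, w⟫) =
      gaussianReal 0 (⟪w, op S w⟫).toNNReal := by
  have h : (fun x : Vec p => ⟪x - m, w⟫) = (fun y => y + -⟪w, m⟫) ∘ (innerSL ℝ w) := by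
    ext x
    simp only [Function.comp, innerSL_apply_apply, real_inner_comm w, inner_sub_right]
    ring
  have hv : Var[innerSL ℝ w; multivariateGaussian m S] = ⟪w, op S w⟫ := by
    have h1 := covarianceBilin_multivariateGaussian (μ := m) hS.posSemidef w w
    rw [covarianceBilin_self IsGaussian.memLp_two_id] at h1
    rw [Matrix.inner_toEuclideanCLM, ← h1]
    rfl
  rw [h, ← Measure.map_map (by fun_prop) (by fun_prop), IsGaussian.map_eq_gaussianReal,
    gaussianReal_map_add_const, hv,
    ContinuousLinearMap.integral_comp_comm _ IsGaussian.integrable_fun_id]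
  simp

lemma inner_op_self_nonneg (hS : S.PosDef) (w : Vec p) : 0 ≤ ⟪w, op S w⟫ := by
  rw [← sqrt_mul_sqrt hS, op_mul_apply]
  have := real_inner_self_nonneg (x := op (CFC.sqrt S) w)
  rwa [inner_op_left, isHermitian_transpose_eq (sqrt_isHermitian S)] at this

lemma memLp_inner_sub (hS : S.PosDef) (w : Vec p) {q : ℝ≥0∞} (hq : q ≠ ∞) :
    MemLp (fun x => ⟪x - m, w⟫) q (multivariateGaussian m S) := by
  have h := memLp_id_gaussianReal' (μ := 0) (v := (⟪w, op S w⟫).toNNReal) q hq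
  rw [← map_inner_sub (m := m) hS w] at h
  exact (memLp_map_measure_iff (f := fun x : Vec p => ⟪x - m, w⟫) (g := id) (by fun_prop)
    (by fun_prop)).1 h

lemma integrable_inner_sub_pow (hS : S.PosDef) (w : Vec p) (k : ℕ) :
    Integrable (fun x => ⟪x - m, w⟫ ^ k) (multivariateGaussian m S) := by
  have h : Integrable (fun y : ℝ => y ^ k) (gaussianReal 0 (⟪w, op S w⟫).toNNReal) := by
    rcases Nat.eq_zero_or_pos k with rfl | hk
    · simp
    · have := (memLp_id_gaussianReal' (μ := 0) (v := (⟪w, op S w⟫).toNNReal) k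
        (by simp)).integrable_norm_pow hk.ne'
      refine this.mono (by fun_prop) (Eventually.of_forall fun x => by simp)
  rw [← map_inner_sub (m := m) hS w] at h
  exact (integrable_map_measure (f := fun x : Vec p => ⟪x - m, w⟫) (g := fun y : ℝ => y ^ k)
    (by fun_prop) (by fun_prop)).1 h

lemma integral_inner_sub_pow_four (hS : S.PosDef) (w : Vec p) :
    ∫ x, ⟪x - m, w⟫ ^ 4 ∂(multivariateGaussian m S) =
      ⟪w, op S w⟫ ^ 2 * gaussianFourthMoment := by
  have h := integral_pow_four_gaussianReal (⟪w, op S w⟫).toNNReal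
  rw [← map_inner_sub (m := m) hS w, integral_map (by fun_prop) (by fun_prop),
    Real.coe_toNNReal _ (inner_op_self_nonneg hS w)] at h
  exact h

lemma integral_inner_sub_sq (hS : S.PosDef) (w : Vec p) :
    ∫ x, ⟪x - m, w⟫ ^ 2 ∂(multivariateGaussian m S) = ⟪w, op S w⟫ := by
  have h := variance_id_gaussianReal (μ := 0) (v := (⟪w, op S w⟫).toNNReal)
  rw [variance_eq_integral (by fun_prop), Real.coe_toNNReal _ (inner_op_self_nonneg hS w),
    ← map_inner_sub (m := m) hS w, integral_map (by fun_prop) (by fun_prop)] at h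
  rw [← h, map_inner_sub hS w]
  simp

lemma integral_inner_sub_mul (hS : S.PosDef) (w y : Vec p) :
    ∫ x, ⟪x - m, w⟫ * ⟪x - m, y⟫ ∂(multivariateGaussian m S) = ⟪w, op S y⟫ := by
  have e : ∀ x, ⟪x - m, w⟫ * ⟪x - m, y⟫ =
      (⟪x - m, w + y⟫ ^ 2 - ⟪x - m, w⟫ ^ 2 - ⟪x - m, y⟫ ^ 2) / 2 := fun x => by
    rw [inner_add_right]
    ring
  simp_rw [e]
  have hi : Integrable (fun x => ⟪x - m, w + y⟫ ^ 2 - ⟪x - m, w⟫ ^ 2) (multivariateGaussian m S) :=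
    (integrable_inner_sub_pow hS _ 2).sub (integrable_inner_sub_pow hS _ 2)
  rw [integral_div, integral_sub hi (integrable_inner_sub_pow hS _ 2),
    integral_sub (integrable_inner_sub_pow hS _ 2) (integrable_inner_sub_pow hS _ 2),
    integral_inner_sub_sq hS, integral_inner_sub_sq hS, integral_inner_sub_sq hS, map_add,
    inner_add_left, inner_add_right, inner_add_right, inner_op_symm hS.isHermitian y w]
  ring

lemma inner_op_self_le (S : Mat p) (w : Vec p) : ⟪w, op S w⟫ ≤ specNorm S * ‖w‖ ^ 2 := by
  rw [sq]
  exact (le_abs_self _).trans (abs_inner_op_le _ _ _)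

/-- The product is split into fourth powers by the arithmetic–geometric mean inequality with weight
‖y‖², which balances the two fourth moments. The numerical value of the Gaussian fourth moment plays
no role. -/
lemma integral_inner_sub_mul_sq_le (hS : S.PosDef) {w y : Vec p} (hw : ‖w‖ = 1) :
    ∫ x, (⟪x - m, w⟫ * ⟪x - m, y⟫) ^ 2 ∂(multivariateGaussian m S) ≤
      gaussianFourthMoment * specNorm S ^ 2 * ‖y‖ ^ 2 := by
  have hs := specNorm_nonneg S
  have hg := gaussianFourthMoment_nonneg
  have h4 : ∀ x : Vec p, ∫ z, ⟪z - m, x⟫ ^ 4 ∂(multivariateGaussian m S) ≤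
      (specNorm S * ‖x‖ ^ 2) ^ 2 * gaussianFourthMoment := by
    intro x
    rw [integral_inner_sub_pow_four hS]
    have := inner_op_self_nonneg hS x
    have := inner_op_self_le S x
    gcongr
  rcases eq_or_ne y 0 with rfl | hy
  · simp
  have hl : 0 < ‖y‖ ^ 2 := by positivity
  set l := ‖y‖ ^ 2 with hl'
  have hint1 := (integrable_inner_sub_pow (m := m) hS w 4).const_mul (l / 2)
  have hint2 := (integrable_inner_sub_pow (m := m) hS y 4).const_mul (1 / (2 * l))
  calc ∫ x, (⟪x - m, w⟫ * ⟪x - m, y⟫) ^ 2 ∂(multivariateGaussian m S)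
      ≤ ∫ x, (l / 2 * ⟪x - m, w⟫ ^ 4 + 1 / (2 * l) * ⟪x - m, y⟫ ^ 4)
          ∂(multivariateGaussian m S) := by
        refine integral_mono_of_nonneg (Eventually.of_forall fun x => by positivity)
          (hint1.add hint2) (Eventually.of_forall fun x => ?_)
        simp only
        have h := sq_nonneg (l * ⟪x - m, w⟫ ^ 2 - ⟪x - m, y⟫ ^ 2)
        have e : l / 2 * ⟪x - m, w⟫ ^ 4 + 1 / (2 * l) * ⟪x - m, y⟫ ^ 4
            - (⟪x - m, w⟫ * ⟪x - m, y⟫) ^ 2 =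
            (l * ⟪x - m, w⟫ ^ 2 - ⟪x - m, y⟫ ^ 2) ^ 2 / (2 * l) := by
          field_simp
          ring
        have : 0 ≤ (l * ⟪x - m, w⟫ ^ 2 - ⟪x - m, y⟫ ^ 2) ^ 2 / (2 * l) := by positivity
        linarith
    _ = l / 2 * ∫ x, ⟪x - m, w⟫ ^ 4 ∂(multivariateGaussian m S)
        + 1 / (2 * l) * ∫ x, ⟪x - m, y⟫ ^ 4 ∂(multivariateGaussian m S) := by
        rw [integral_add hint1 hint2, integral_const_mul, integral_const_mul]
    _ ≤ l / 2 * ((specNorm S * ‖w‖ ^ 2) ^ 2 * gaussianFourthMoment)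
        + 1 / (2 * l) * ((specNorm S * ‖y‖ ^ 2) ^ 2 * gaussianFourthMoment) := by
        gcongr
        · exact h4 w
        · exact h4 y
    _ = _ := by
        rw [hw, ← hl']
        field_simp
        ring

lemma memLp_inner_sub_mul (hS : S.PosDef) (w y : Vec p) :
    MemLp (fun x => ⟪x - m, w⟫ * ⟪x - m, y⟫) 2 (multivariateGaussian m S) := by
  have : ENNReal.HolderTriple 4 4 2 := ⟨by
    rw [← two_mul, show (4 : ℝ≥0∞) = 2 * 2 by norm_num,
      ENNReal.mul_inv (by simp) (by simp), ← mul_assoc,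
      ENNReal.mul_inv_cancel (by simp) (by simp), one_mul]⟩
  exact (memLp_inner_sub hS y (q := 4) (by simp)).mul' (memLp_inner_sub hS w (q := 4) (by simp))

end GaussianMoments

section Samples

/-- `f` is integrable with mean at most `b`. -/
def MeanLe {Ω : Type*} [MeasurableSpace Ω] (μ : Measure Ω) (f : Ω → ℝ) (b : ℝ) : Prop :=
  Integrable f μ ∧ ∫ x, f x ∂μ ≤ b

lemma MeanLe.sum {Ω ι : Type*} [MeasurableSpace Ω] {μ : Measure Ω} {s : Finset ι}
    {f : ι → Ω → ℝ} {b : ι → ℝ} (h : ∀ i ∈ s, MeanLe μ (f i) (b i)) :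
    MeanLe μ (fun x => ∑ i ∈ s, f i x) (∑ i ∈ s, b i) :=
  ⟨integrable_finsetSum s fun i hi => (h i hi).1, by
    rw [integral_finsetSum s fun i hi => (h i hi).1]
    exact Finset.sum_le_sum fun i hi => (h i hi).2⟩

lemma MeanLe.markov {Ω : Type*} [MeasurableSpace Ω] {μ : Measure Ω} [IsFiniteMeasure μ]
    {f : Ω → ℝ} {b c : ℝ} (h : MeanLe μ f b) (hf : ∀ x, 0 ≤ f x) (hc : 0 < c) :
    μ {x | c ≤ f x} ≤ ENNReal.ofReal (b / c) := by
  have h1 := mul_meas_ge_le_integral_of_nonneg (Eventually.of_forall hf) h.1 c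
  rw [← ENNReal.ofReal_toReal (measure_ne_top μ {x | c ≤ f x})]
  apply ENNReal.ofReal_le_ofReal
  rw [le_div_iff₀ hc, mul_comm]
  exact h1.trans h.2

/-- The variance of an average of n independent copies is Var f / n, and Var f ≤ E f². -/
lemma meanLe_sq_sub_integral {Ω : Type*} [MeasurableSpace Ω] {ν : Measure Ω}
    [IsProbabilityMeasure ν] {n : ℕ} (hn : n ≠ 0) {f : Ω → ℝ} (hf : MemLp f 2 ν) :
    MeanLe (Measure.pi fun _ : Fin n => ν)
      (fun x => ((1 / (n : ℝ)) * ∑ i, f (x i) - ∫ y, f y ∂ν) ^ 2) ((∫ y, f y ^ 2 ∂ν) / n) := by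
  have hn' : (n : ℝ) ≠ 0 := by exact_mod_cast hn
  have hmem : ∀ i : Fin n, MemLp (fun x : Fin n → Ω => f (x i)) 2 (Measure.pi fun _ => ν) :=
    fun i => hf.comp_measurePreserving (measurePreserving_eval (fun _ : Fin n => ν) i)
  have hsum : MemLp (fun x : Fin n → Ω => ∑ i, f (x i)) 2 (Measure.pi fun _ => ν) :=
    memLp_finsetSum _ fun i _ => hmem i
  have hmean : ∫ x : Fin n → Ω, ∑ i, f (x i) ∂(Measure.pi fun _ => ν) = n * ∫ y, f y ∂ν := by
    rw [integral_finsetSum _ fun i _ => (hmem i).integrable (by norm_num)]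
    have : ∀ i : Fin n, ∫ x : Fin n → Ω, f (x i) ∂(Measure.pi fun _ => ν) = ∫ y, f y ∂ν := by
      intro i
      have hmap := (measurePreserving_eval (fun _ : Fin n => ν) i).map_eq
      have h := integral_map (μ := Measure.pi fun _ : Fin n => ν) (φ := Function.eval i) (f := f)
        (measurable_pi_apply i).aemeasurable (by rw [hmap]; exact hf.1)
      rw [hmap] at h
      exact h.symm
    simp [this]
  have hvar : Var[fun x : Fin n → Ω => ∑ i, f (x i); Measure.pi fun _ => ν] = n * Var[f; ν] := by
    have h := variance_sum_pi (μ := fun _ : Fin n => ν) (X := fun _ => f) fun _ => hf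
    have e : (∑ i : Fin n, fun ω : Fin n → Ω => f (ω i)) = fun x => ∑ i, f (x i) := by
      ext x
      simp
    rw [e] at h
    rw [h]
    simp
  have e : ∀ x : Fin n → Ω, ((1 / (n : ℝ)) * ∑ i, f (x i) - ∫ y, f y ∂ν) ^ 2 =
      (1 / (n : ℝ) ^ 2) * (∑ i, f (x i) - n * ∫ y, f y ∂ν) ^ 2 := by
    intro x
    field_simp
  simp_rw [e]
  refine ⟨((hsum.sub (memLp_const _)).integrable_sq).const_mul _, ?_⟩
  rw [integral_const_mul, ← hmean, ← variance_eq_integral hsum.1.aemeasurable, hvar]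
  have hle : Var[f; ν] ≤ ∫ y, f y ^ 2 ∂ν := variance_le_expectation_sq hf.1
  calc 1 / (n : ℝ) ^ 2 * (n * Var[f; ν]) = Var[f; ν] / n := by field_simp
    _ ≤ _ := by gcongr

variable {n p : ℕ} {m : Vec p} {S : Mat p}

lemma inner_single (x : Vec p) (j : Fin p) : ⟪x, EuclideanSpace.single j (1 : ℝ)⟫ = x j := by
  simp [EuclideanSpace.inner_single_right]

lemma norm_single (j : Fin p) : ‖(EuclideanSpace.single j (1 : ℝ) : Vec p)‖ = 1 := by
  simp

lemma meanLe_norm_sampleMean_sub (hn : n ≠ 0) (hS : S.PosDef) :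
    MeanLe (Measure.pi fun _ : Fin n => multivariateGaussian m S)
      (fun x => ‖sampleMean x - m‖ ^ 2) (p * specNorm S / n) := by
  have hn' : (n : ℝ) ≠ 0 := by exact_mod_cast hn
  have e : ∀ x : Fin n → Vec p, ‖sampleMean x - m‖ ^ 2 = ∑ j, ((1 / (n : ℝ)) *
      ∑ i, ⟪x i - m, EuclideanSpace.single j (1 : ℝ)⟫
      - ∫ y, ⟪y - m, EuclideanSpace.single j (1 : ℝ)⟫ ∂(multivariateGaussian m S)) ^ 2 := by
    intro x
    rw [vec_norm_sq]
    refine Finset.sum_congr rfl fun j _ => ?_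
    rw [integral_inner_sub]
    simp only [inner_single, PiLp.sub_apply, sampleMean, PiLp.smul_apply, WithLp.ofLp_sum,
      Finset.sum_apply, smul_eq_mul, Finset.sum_sub_distrib, Finset.sum_const, Finset.card_univ,
      Fintype.card_fin, nsmul_eq_mul]
    congr 1
    field_simp
    ring
  simp_rw [e]
  have h := MeanLe.sum (s := Finset.univ) fun j (_ : j ∈ Finset.univ) =>
    meanLe_sq_sub_integral (n := n) hn
      (memLp_inner_sub (m := m) hS (EuclideanSpace.single j (1 : ℝ)) (q := 2) (by simp))
  refine ⟨h.1, h.2.trans ?_⟩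
  calc _ ≤ ∑ _j : Fin p, specNorm S / n := by
        refine Finset.sum_le_sum fun j _ => ?_
        rw [integral_inner_sub_sq hS]
        gcongr
        refine (inner_op_self_le S _).trans ?_
        rw [norm_single]
        simp
    _ = _ := by simp [mul_div_assoc]

/-- Each of the p coordinates is a centred average of n products with bounded second moment. For a
fixed `w` this costs p/n, whereas summing over all basis vectors for the Frobenius norm costs p²/n.
-/
lemma meanLe_norm_op_scatter_sub (hn : n ≠ 0) (hS : S.PosDef) (w : Vec p) :
    MeanLe (Measure.pi fun _ : Fin n => multivariateGaussian m S)
      (fun x => ‖op (scatter x m - S) w‖ ^ 2)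
      (p * (gaussianFourthMoment * specNorm S ^ 2) / n * ‖w‖ ^ 2) := by
  have hn' : (n : ℝ) ≠ 0 := by exact_mod_cast hn
  have e : ∀ x : Fin n → Vec p, ‖op (scatter x m - S) w‖ ^ 2 = ∑ j, ((1 / (n : ℝ)) *
      ∑ i, ⟪x i - m, EuclideanSpace.single j (1 : ℝ)⟫ * ⟪x i - m, w⟫
      - ∫ y, ⟪y - m, EuclideanSpace.single j (1 : ℝ)⟫ * ⟪y - m, w⟫
        ∂(multivariateGaussian m S)) ^ 2 := by
    intro x
    rw [vec_norm_sq]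
    refine Finset.sum_congr rfl fun j _ => ?_
    rw [integral_inner_sub_mul hS, real_inner_comm, inner_single]
    have h1 : op (scatter x m - S) w = (1 / (n : ℝ)) • ∑ i, ⟪x i - m, w⟫ • (x i - m) - op S w := by
      simp only [op, scatter, map_sub, map_smul, map_sum]
      simp only [FunLike.coe_sub, Pi.sub_apply, FunLike.coe_smul, Pi.smul_apply,
        FunLike.coe_sum, Finset.sum_apply]
      congr 2
      exact Finset.sum_congr rfl fun i _ => op_outer _ _ _
    rw [h1]
    simp only [inner_single, PiLp.sub_apply, PiLp.smul_apply, WithLp.ofLp_sum,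
      Finset.sum_apply, smul_eq_mul]
    congr 3
    exact Finset.sum_congr rfl fun i _ => mul_comm _ _
  simp_rw [e]
  have h := MeanLe.sum (s := Finset.univ) fun j (_ : j ∈ Finset.univ) =>
    meanLe_sq_sub_integral (n := n) hn
      (memLp_inner_sub_mul (m := m) hS (EuclideanSpace.single j (1 : ℝ)) w)
  refine ⟨h.1, h.2.trans ?_⟩
  calc _ ≤ ∑ _j : Fin p, gaussianFourthMoment * specNorm S ^ 2 * ‖w‖ ^ 2 / n := by
        refine Finset.sum_le_sum fun j _ => ?_
        gcongr
        exact integral_inner_sub_mul_sq_le hS (norm_single j)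
    _ = _ := by
        rw [Finset.sum_const, Finset.card_univ, Fintype.card_fin, nsmul_eq_mul]
        ring

lemma frobSq_eq_sum_norm_op (A : Mat p) :
    frobSq A = ∑ j, ‖op A (EuclideanSpace.single j (1 : ℝ))‖ ^ 2 := by
  rw [frobSq_eq_sum_col]
  refine Finset.sum_congr rfl fun j _ => ?_
  congr 2
  ext i
  rw [op_apply]
  simp

lemma meanLe_frobSq_scatter_sub (hn : n ≠ 0) (hS : S.PosDef) :
    MeanLe (Measure.pi fun _ : Fin n => multivariateGaussian m S)
      (fun x => frobSq (scatter x m - S))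
      (p * (p * (gaussianFourthMoment * specNorm S ^ 2) / n)) := by
  simp_rw [frobSq_eq_sum_norm_op]
  have h := MeanLe.sum (s := Finset.univ) fun j (_ : j ∈ Finset.univ) =>
    meanLe_norm_op_scatter_sub (n := n) (m := m) hn hS (EuclideanSpace.single j (1 : ℝ))
  refine ⟨h.1, h.2.trans (le_of_eq ?_)⟩
  simp

/-- The sample mean and the sample covariance are close to their expectations, the latter also
along the given directions `w`. -/
structure GoodSample {ι : Type*} (m : Vec p) (S : Mat p) (w : ι → Vec p) (κ : ℝ)
    (x : Fin n → Vec p) : Prop where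
  mean : ‖sampleMean x - m‖ ^ 2 ≤ κ / √(n : ℝ)
  dir : ∀ k, ‖op (scatter x m - S) (w k)‖ ^ 2 ≤ κ / √(n : ℝ) * ‖w k‖ ^ 2
  frob : frobSq (scatter x m - S) ≤ κ ^ 2

lemma measure_not_goodSample_le {ι : Type*} [Fintype ι] (hn : n ≠ 0) (hS : S.PosDef) {C : ℝ}
    (hC : specNorm S ≤ C) (w : ι → Vec p) {κ : ℝ} (hκ : 0 < κ) :
    (Measure.pi fun _ : Fin n => multivariateGaussian m S) {x | ¬ GoodSample m S w κ x} ≤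
      ENNReal.ofReal (p / √(n : ℝ) * (C / κ))
      + (Fintype.card ι * ENNReal.ofReal (p / √(n : ℝ) * (gaussianFourthMoment * C ^ 2 / κ))
      + ENNReal.ofReal ((p / √(n : ℝ)) ^ 2 * (gaussianFourthMoment * C ^ 2 / κ ^ 2))) := by
  set P := Measure.pi fun _ : Fin n => multivariateGaussian m S
  have hg := gaussianFourthMoment_nonneg
  have hs := specNorm_nonneg S
  have hnpos : 0 < (n : ℝ) := by exact_mod_cast Nat.pos_of_ne_zero hn
  set N := √(n : ℝ) with hN
  have hNpos : 0 < N := Real.sqrt_pos.2 hnpos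
  have hNsq : (n : ℝ) = N ^ 2 := (Real.sq_sqrt hnpos.le).symm
  have hsub : {x : Fin n → Vec p | ¬ GoodSample m S w κ x} ⊆
      {x | κ / N ≤ ‖sampleMean x - m‖ ^ 2} ∪
      ((⋃ k, {x | ¬ ‖op (scatter x m - S) (w k)‖ ^ 2 ≤ κ / N * ‖w k‖ ^ 2}) ∪
      {x | κ ^ 2 ≤ frobSq (scatter x m - S)}) := by
    intro x hx
    by_contra! hcon
    simp only [Set.mem_union, Set.mem_iUnion, Set.mem_ofPred_eq, not_or, not_exists, not_le]
      at hcon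
    exact hx ⟨hcon.1.le, fun k => not_lt.1 (hcon.2.1 k), hcon.2.2.le⟩
  refine (measure_mono hsub).trans ((measure_union_le _ _).trans (add_le_add ?_
    ((measure_union_le _ _).trans (add_le_add ((measure_iUnion_fintype_le _ _).trans ?_) ?_))))
  · refine ((meanLe_norm_sampleMean_sub hn hS).markov (fun x => sq_nonneg _)
      (by positivity)).trans (ENNReal.ofReal_le_ofReal ?_)
    calc p * specNorm S / n / (κ / N) = p / N * (specNorm S / κ) := by
          rw [hNsq]
          field_simp
      _ ≤ _ := by gcongr
  · rw [← nsmul_eq_mul]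
    refine Finset.sum_le_card_nsmul _ _ _ fun k _ => ?_
    -- For a zero direction the Markov threshold would be 0, but then the required inequality holds
    -- trivially; hence the bad event is kept as a negated inequality.
    rcases eq_or_ne (w k) 0 with h0 | h0
    · simp [h0]
    have hw : 0 < ‖w k‖ ^ 2 := by positivity
    refine (measure_mono (t := {x | κ / N * ‖w k‖ ^ 2 ≤ ‖op (scatter x m - S) (w k)‖ ^ 2})
      fun x hx => (not_le.1 hx).le).trans ?_
    refine ((meanLe_norm_op_scatter_sub hn hS (w k)).markov (fun x => sq_nonneg _)
      (by positivity)).trans (ENNReal.ofReal_le_ofReal ?_)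
    calc p * (gaussianFourthMoment * specNorm S ^ 2) / n * ‖w k‖ ^ 2 / (κ / N * ‖w k‖ ^ 2)
        = p / N * (gaussianFourthMoment * specNorm S ^ 2 / κ) := by
          rw [hNsq]
          field_simp
      _ ≤ _ := by gcongr
  · refine ((meanLe_frobSq_scatter_sub hn hS).markov (fun x => frobSq_nonneg _)
      (by positivity)).trans (ENNReal.ofReal_le_ofReal ?_)
    calc p * (p * (gaussianFourthMoment * specNorm S ^ 2) / n) / κ ^ 2
        = (p / N) ^ 2 * (gaussianFourthMoment * specNorm S ^ 2 / κ ^ 2) := by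
          rw [hNsq]
          field_simp
      _ ≤ _ := by gcongr

/-- The directions along which the sample covariance has to be controlled. -/
noncomputable def Truth.directions (T : Truth p) : Fin 4 → Vec p :=
  ![op T.prec (T.z - T.muX), op T.prec (T.z - T.muY),
    op T.prec ((T.z - T.muX) + (T.z - T.muY)), op T.prec ((T.z - T.muX) - (T.z - T.muY))]

lemma scatter_isHermitian (x : Fin n → Vec p) (m : Vec p) : (scatter x m).IsHermitian := by
  rw [Matrix.IsHermitian, Matrix.conjTranspose_eq_transpose_of_trivial, scatter,
    Matrix.transpose_smul, Matrix.transpose_sum]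
  simp only [transpose_outer]

lemma pooledCov_isHermitian (D : Data n p) : (pooledCov D).IsHermitian :=
  ((scatter_isHermitian _ _).add (scatter_isHermitian _ _)).smul (k := (1 / 2 : ℝ)) rfl

lemma specNorm_outer_self_le (x : Vec p) : specNorm (outer x x) ≤ ‖x‖ ^ 2 := by
  have h := specNorm_sq_le_frobSq (outer x x)
  rw [frobSq_outer_self] at h
  exact le_of_sq_le_sq h (sq_nonneg _)

lemma specNorm_smul (c : ℝ) (A : Mat p) : specNorm (c • A) = |c| * specNorm A := by
  unfold specNorm
  rw [map_smul, norm_smul, Real.norm_eq_abs]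

/-- Centering at the sample means changes the average scatter around the true means by ½(uuᵀ + vvᵀ),
which is of order κ/√n. In 4C², the 4 is the square of the number of error contributions after
averaging and C² comes from ‖Ω*‖². -/
lemma goodData_of_goodSample (hn : n ≠ 0) {T : Truth p} {C : ℝ} (hT : T.BoundedBy C)
    {D : Data n p} {κ κ' : ℝ} (hκ1 : κ ≤ 1) (hκκ : 4 * C ^ 2 * κ ≤ κ')
    (hκ0 : 0 < κ) (hX : GoodSample T.muX T.cov T.directions κ D.1)
    (hY : GoodSample T.muY T.cov T.directions κ D.2) : GoodData T D κ' := by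
  have hC := hT.one_le
  have hnpos : 1 ≤ (n : ℝ) := by exact_mod_cast Nat.one_le_iff_ne_zero.2 hn
  set N := √(n : ℝ) with hN
  have hN1 : 1 ≤ N := Real.one_le_sqrt.2 hnpos
  have hNpos : 0 < N := by linarith
  set u := sampleMean D.1 - T.muX with hu
  set v := sampleMean D.2 - T.muY with hv
  have hC2 : 1 ≤ C ^ 2 := one_le_pow₀ hC
  have hκle : κ ≤ κ' := by nlinarith
  have hτ : κ / N ≤ κ := div_le_self hκ0.le hN1
  set τ := κ / N with hτdef
  have hτ0 : 0 < τ := by positivity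
  set EX := scatter D.1 T.muX - T.cov
  set EY := scatter D.2 T.muY - T.cov
  have hE : pooledCov D - T.cov = (1 / 2 : ℝ) • (EX + EY) - (1 / 2 : ℝ) • (outer u u + outer v v) := by
    rw [pooledCov, ← sub_eq_iff_eq_add.2 (scatter_eq_add_outer hn D.1 T.muX),
      ← sub_eq_iff_eq_add.2 (scatter_eq_add_outer hn D.2 T.muY)]
    ext i j
    simp only [EX, EY, Matrix.sub_apply, Matrix.smul_apply, Matrix.add_apply, smul_eq_mul, ← hu, ← hv]
    ring
  have hu2 : ‖u‖ ^ 2 ≤ τ := hX.mean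
  have hv2 : ‖v‖ ^ 2 ≤ τ := hY.mean
  have hnorm : ∀ y : Vec p, ‖op EX y‖ ^ 2 ≤ τ * ‖y‖ ^ 2 → ‖op EY y‖ ^ 2 ≤ τ * ‖y‖ ^ 2 →
      ‖op (pooledCov D - T.cov) y‖ ^ 2 ≤ 4 * τ * ‖y‖ ^ 2 := by
    intro y h1 h2
    have e : op (pooledCov D - T.cov) y =
        (1 / 2 : ℝ) • (op EX y + op EY y) - (1 / 2 : ℝ) • (op (outer u u) y + op (outer v v) y) := by
      rw [hE]
      simp only [op, map_sub, map_smul, map_add]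
      rfl
    have h1' : ‖op EX y‖ ≤ √τ * ‖y‖ := by
      apply le_of_sq_le_sq _ (by positivity)
      rwa [mul_pow, Real.sq_sqrt hτ0.le]
    have h2' : ‖op EY y‖ ≤ √τ * ‖y‖ := by
      apply le_of_sq_le_sq _ (by positivity)
      rwa [mul_pow, Real.sq_sqrt hτ0.le]
    have hτs : τ ≤ √τ := Real.le_sqrt_of_sq_le (by nlinarith)
    have ho : ∀ x : Vec p, ‖x‖ ^ 2 ≤ τ → ‖op (outer x x) y‖ ≤ √τ * ‖y‖ := by
      intro x hx
      refine (norm_op_le _ _).trans ?_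
      gcongr
      exact (specNorm_outer_self_le x).trans (hx.trans hτs)
    have h3 := ho u hu2
    have h4 := ho v hv2
    have : ‖op (pooledCov D - T.cov) y‖ ≤ 2 * (√τ * ‖y‖) := by
      rw [e]
      refine (norm_sub_le _ _).trans ?_
      rw [norm_smul, norm_smul]
      have a1 := norm_add_le (op EX y) (op EY y)
      have a2 := norm_add_le (op (outer u u) y) (op (outer v v) y)
      norm_num
      linarith
    calc _ ≤ (2 * (√τ * ‖y‖)) ^ 2 := pow_le_pow_left₀ (norm_nonneg _) this 2
      _ = 4 * √τ ^ 2 * ‖y‖ ^ 2 := by ring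
      _ = _ := by rw [Real.sq_sqrt hτ0.le]
  have hdir : ∀ x : Vec p, ∀ k, T.directions k = op T.prec x →
      ‖op (pooledCov D - T.cov) (op T.prec x)‖ ^ 2 ≤ κ' / N * ‖x‖ ^ 2 := by
    intro x k hk
    have h1 := hX.dir k
    have h2 := hY.dir k
    rw [hk] at h1 h2
    refine (hnorm _ h1 h2).trans ?_
    have hP : ‖op T.prec x‖ ^ 2 ≤ C ^ 2 * ‖x‖ ^ 2 := by
      rw [← mul_pow]
      exact pow_le_pow_left₀ (norm_nonneg _) ((norm_op_le _ _).trans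
        (mul_le_mul_of_nonneg_right hT.prec_le (norm_nonneg _))) 2
    calc 4 * τ * ‖op T.prec x‖ ^ 2 ≤ 4 * τ * (C ^ 2 * ‖x‖ ^ 2) := by gcongr
      _ = 4 * C ^ 2 * κ / N * ‖x‖ ^ 2 := by rw [hτdef]; ring
      _ ≤ _ := by gcongr
  refine ⟨⟨(pooledCov_isHermitian D).sub T.posDef.isHermitian, hu2.trans ?_, hv2.trans ?_,
    hdir _ 0 rfl, hdir _ 1 rfl, hdir _ 2 rfl, hdir _ 3 rfl⟩, ?_⟩
  · exact div_le_div_of_nonneg_right hκle hNpos.le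
  · exact div_le_div_of_nonneg_right hκle hNpos.le
  · have hfr : ∀ A : Mat p, frobSq A ≤ κ ^ 2 → specNorm A ≤ κ := fun A hA =>
      le_of_sq_le_sq ((specNorm_sq_le_frobSq A).trans hA) hκ0.le
    have h1 := hfr _ hX.frob
    have h2 := hfr _ hY.frob
    have h3 := specNorm_outer_self_le u
    have h4 := specNorm_outer_self_le v
    rw [hE]
    refine (specNorm_sub_le _ _).trans ?_
    rw [specNorm_smul, specNorm_smul]
    have a1 := specNorm_add_le EX EY
    have a2 := specNorm_add_le (outer u u) (outer v v)
    norm_num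
    nlinarith

lemma dataLaw_not_goodData_le (hn : n ≠ 0) {T : Truth p} {C : ℝ} (hT : T.BoundedBy C)
    {κ κ' : ℝ} (hκ1 : κ ≤ 1) (hκκ : 4 * C ^ 2 * κ ≤ κ') (hκ0 : 0 < κ) :
    T.dataLaw n {D | ¬ GoodData T D κ'} ≤ 2 * (ENNReal.ofReal (p / √(n : ℝ) * (C / κ))
      + (4 * ENNReal.ofReal (p / √(n : ℝ) * (gaussianFourthMoment * C ^ 2 / κ))
      + ENNReal.ofReal ((p / √(n : ℝ)) ^ 2 * (gaussianFourthMoment * C ^ 2 / κ ^ 2)))) := by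
  have hsub : {D : Data n p | ¬ GoodData T D κ'} ⊆
      ({x | ¬ GoodSample T.muX T.cov T.directions κ x} ×ˢ Set.univ) ∪
      (Set.univ ×ˢ {x | ¬ GoodSample T.muY T.cov T.directions κ x}) := by
    intro D hD
    by_contra! hcon
    simp only [Set.mem_union, Set.mem_prod, Set.mem_ofPred_eq, Set.mem_univ, and_true, true_and,
      not_or, not_not] at hcon
    exact hD (goodData_of_goodSample hn hT hκ1 hκκ hκ0 hcon.1 hcon.2)
  refine (measure_mono hsub).trans ((measure_union_le _ _).trans ?_)
  rw [Truth.dataLaw, Measure.prod_prod, Measure.prod_prod, measure_univ, measure_univ, one_mul,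
    mul_one, two_mul]
  have hX := measure_not_goodSample_le (m := T.muX) hn T.posDef hT.cov_le T.directions hκ0
  have hY := measure_not_goodSample_le (m := T.muY) hn T.posDef hT.cov_le T.directions hκ0
  rw [Fintype.card_fin] at hX hY
  exact add_le_add hX hY

end Samples

theorem tendsto_dataLaw_not_goodData {p : ℕ → ℕ} {T : ∀ n, Truth (p n)} {C : ℝ}
    (hT : ∀ᶠ n in atTop, (T n).BoundedBy C)
    (hp : Tendsto (fun n => (p n : ℝ) ^ 2 / (n : ℝ)) atTop (𝓝 0)) {κ : ℝ} (hκ : 0 < κ) :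
    Tendsto (fun n => (T n).dataLaw n {D | ¬ GoodData (T n) D κ}) atTop (𝓝 0) := by
  obtain ⟨n₀, hn₀⟩ := hT.exists
  have hC : 0 < C := by linarith [hn₀.one_le]
  set κ₁ := min 1 (κ / (4 * C ^ 2)) with hκ₁
  have hκ₁0 : 0 < κ₁ := lt_min one_pos (by positivity)
  have hκ₁κ : 4 * C ^ 2 * κ₁ ≤ κ := by
    have : κ₁ ≤ κ / (4 * C ^ 2) := min_le_right _ _
    rwa [le_div_iff₀ (by positivity), mul_comm] at this
  have hr : Tendsto (fun n => (p n : ℝ) / √(n : ℝ)) atTop (𝓝 0) := by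
    have h := (Real.continuous_sqrt.tendsto 0).comp hp
    rw [Real.sqrt_zero] at h
    refine h.congr fun n => ?_
    simp only [Function.comp]
    rw [Real.sqrt_div (sq_nonneg _), Real.sqrt_sq (Nat.cast_nonneg _)]
  have h1 : ∀ c : ℝ, Tendsto (fun n => ENNReal.ofReal ((p n : ℝ) / √(n : ℝ) * c)) atTop (𝓝 0) := by
    intro c
    simpa using ENNReal.tendsto_ofReal (hr.mul_const c)
  have h2 : ∀ c : ℝ, Tendsto (fun n => ENNReal.ofReal (((p n : ℝ) / √(n : ℝ)) ^ 2 * c)) atTop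
      (𝓝 0) := by
    intro c
    simpa using ENNReal.tendsto_ofReal ((hr.pow 2).mul_const c)
  have hlim := ENNReal.Tendsto.const_mul (a := 2) ((h1 (C / κ₁)).add
    ((ENNReal.Tendsto.const_mul (a := 4) (h1 (gaussianFourthMoment * C ^ 2 / κ₁))
      (Or.inr (by simp))).add (h2 (gaussianFourthMoment * C ^ 2 / κ₁ ^ 2)))) (Or.inr (by simp))
  simp only [mul_zero, add_zero] at hlim
  refine tendsto_of_tendsto_of_tendsto_of_le_of_le' tendsto_const_nhds hlim
    (Eventually.of_forall fun _ => zero_le) ?_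
  filter_upwards [hT, eventually_ne_atTop 0] with n hn hn0
  exact dataLaw_not_goodData_le hn0 hn (min_le_left _ _) hκ₁κ hκ₁0

end LDA

/-! ### Measurability and the posterior restricted to a set -/

namespace LDA

section Posterior

variable {n p : ℕ}

lemma continuous_prec : Continuous (fun θ : Param p => θ.prec) :=
  continuous_snd.comp continuous_snd

lemma continuous_quadForm {X : Type*} [TopologicalSpace X] {A : X → Mat p} {x : X → Vec p}
    (hA : Continuous A) (hx : Continuous x) : Continuous fun ω => quadForm (A ω) (x ω) := by
  have h1 : ∀ i j, Continuous fun ω => A ω i j := fun i j => hA.matrix_elem i j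
  have h2 : ∀ i, Continuous fun ω => x ω i := fun i =>
    (EuclideanSpace.proj (𝕜 := ℝ) i).continuous.comp hx
  exact continuous_finsetSum _ fun i _ => continuous_finsetSum _ fun j _ =>
    ((h2 i).mul (h1 i j)).mul (h2 j)

lemma measurable_logLik (hn : n ≠ 0) (D : Data n p) : Measurable fun θ : Param p => logLik D θ := by
  simp_rw [logLik_eq hn]
  have h1 : Continuous fun θ : Param p => θ.prec.det := continuous_prec.matrix_det
  have h2 : Continuous fun θ : Param p => (θ.prec * pooledCov D).trace :=
    (continuous_prec.matrix_mul continuous_const).matrix_trace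
  have h3 : Continuous fun θ : Param p => quadForm θ.prec (sampleMean D.1 - θ.muX) :=
    continuous_quadForm continuous_prec (continuous_const.sub continuous_fst)
  have h4 : Continuous fun θ : Param p => quadForm θ.prec (sampleMean D.2 - θ.muY) :=
    continuous_quadForm continuous_prec
      (continuous_const.sub (continuous_fst.comp continuous_snd))
  exact ((Real.measurable_log.comp h1.measurable).const_mul _).sub
    ((((continuous_const.mul h2).add h3).add h4).measurable.const_mul _)

lemma measurable_stat (T : Truth p) (D : Data n p) : Measurable fun θ : Param p => stat T D θ := by
  have h3 : Continuous fun θ : Param p => quadForm θ.prec (T.z - θ.muX) :=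
    continuous_quadForm continuous_prec (continuous_const.sub continuous_fst)
  have h4 : Continuous fun θ : Param p => quadForm θ.prec (T.z - θ.muY) :=
    continuous_quadForm continuous_prec
      (continuous_const.sub (continuous_fst.comp continuous_snd))
  exact (continuous_const.mul ((h3.neg.add h4).sub continuous_const)).measurable

variable {Ω : Type*} [MeasurableSpace Ω] {π : Measure Ω} {f : Ω → ℝ≥0∞} {A : Set Ω}

/-- The law of `W` under the measure with density `f` restricted to `A` and normalized. -/
noncomputable def restrictedLaw (π : Measure Ω) (f : Ω → ℝ≥0∞) (A : Set Ω) (W : Ω → ℝ) :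
    Measure ℝ :=
  ((∫⁻ θ in A, f θ ∂π)⁻¹ • (π.restrict A).withDensity f).map W

lemma isProbabilityMeasure_restrictedLaw {W : Ω → ℝ} (hW : Measurable W)
    (h0 : ∫⁻ θ in A, f θ ∂π ≠ 0) (h1 : ∫⁻ θ in A, f θ ∂π ≠ ∞) :
    IsProbabilityMeasure (restrictedLaw π f A W) := by
  constructor
  rw [restrictedLaw, Measure.map_apply hW MeasurableSet.univ, Set.preimage_univ,
    Measure.smul_apply, withDensity_apply _ MeasurableSet.univ, Measure.restrict_univ, smul_eq_mul,
    ENNReal.inv_mul_cancel h0 h1]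

lemma lintegral_restrictedLaw {W : Ω → ℝ} (hW : Measurable W) (hf : Measurable f) {g : ℝ → ℝ≥0∞}
    (hg : Measurable g) :
    ∫⁻ x, g x ∂(restrictedLaw π f A W) =
      (∫⁻ θ in A, f θ ∂π)⁻¹ * ∫⁻ θ in A, f θ * g (W θ) ∂π := by
  rw [restrictedLaw, lintegral_map hg hW, lintegral_smul_measure, smul_eq_mul]
  congr 1
  exact lintegral_withDensity_eq_lintegral_mul _ hf (hg.comp hW)

/-- Conditioning a probability measure on `A` changes the probability of any event by at most the
mass of the complement of `A`. -/
lemma abs_ratio_sub_restrictedLaw_le (hA : MeasurableSet A) {W : Ω → ℝ}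
    (hW : Measurable W) (h0 : ∫⁻ θ in A, f θ ∂π ≠ 0) (h1 : ∫⁻ θ, f θ ∂π ≠ ∞) (s : ℝ) :
    |((∫⁻ θ in {θ | W θ ≤ s}, f θ ∂π) / ∫⁻ θ, f θ ∂π).toReal
      - (restrictedLaw π f A W).real (Set.Iic s)| ≤
      1 - ((∫⁻ θ in A, f θ ∂π) / ∫⁻ θ, f θ ∂π).toReal := by
  set B : Set Ω := {θ | W θ ≤ s} with hB
  have hBm : MeasurableSet B := measurableSet_le hW measurable_const
  have hlaw : (restrictedLaw π f A W) (Set.Iic s) =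
      (∫⁻ θ in B ∩ A, f θ ∂π) / ∫⁻ θ in A, f θ ∂π := by
    rw [restrictedLaw, Measure.map_apply hW measurableSet_Iic, Measure.smul_apply,
      withDensity_apply _ (hW measurableSet_Iic), Measure.restrict_restrict (hW measurableSet_Iic),
      smul_eq_mul, ENNReal.div_eq_inv_mul]
    rfl
  have le_all : ∀ S : Set Ω, ∫⁻ θ in S, f θ ∂π ≤ ∫⁻ θ, f θ ∂π := fun S =>
    setLIntegral_le_lintegral S f
  have fin : ∀ S : Set Ω, ∫⁻ θ in S, f θ ∂π ≠ ∞ := fun S => ne_top_of_le_ne_top h1 (le_all S)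
  have hxa : ∫⁻ θ in B ∩ A, f θ ∂π ≤ ∫⁻ θ in A, f θ ∂π :=
    lintegral_mono_set Set.inter_subset_right
  have hxy : ∫⁻ θ in B ∩ A, f θ ∂π ≤ ∫⁻ θ in B, f θ ∂π :=
    lintegral_mono_set Set.inter_subset_left
  have hyx : ∫⁻ θ in B, f θ ∂π + ∫⁻ θ in A, f θ ∂π ≤
      ∫⁻ θ in B ∩ A, f θ ∂π + ∫⁻ θ, f θ ∂π := by
    rw [← lintegral_inter_add_sdiff f B hA, add_assoc]
    gcongr
    calc ∫⁻ θ in B \ A, f θ ∂π + ∫⁻ θ in A, f θ ∂π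
        ≤ ∫⁻ θ in Aᶜ, f θ ∂π + ∫⁻ θ in A, f θ ∂π :=
          add_le_add (lintegral_mono_set fun x hx => hx.2) le_rfl
      _ = ∫⁻ θ, f θ ∂π := by rw [add_comm, lintegral_add_compl f hA]
  rw [measureReal_def, hlaw, ENNReal.toReal_div, ENNReal.toReal_div, ENNReal.toReal_div]
  have r1 := ENNReal.toReal_mono (fin _) hxa
  have r2 := ENNReal.toReal_mono (fin _) hxy
  have r3 := ENNReal.toReal_mono (ENNReal.add_ne_top.2 ⟨fin _, h1⟩) hyx
  rw [ENNReal.toReal_add (fin _) (fin _), ENNReal.toReal_add (fin _) h1] at r3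
  have r4 := ENNReal.toReal_mono h1 (le_all A)
  have r5 : 0 < (∫⁻ θ in A, f θ ∂π).toReal := ENNReal.toReal_pos h0 (fin A)
  have r6 : 0 ≤ (∫⁻ θ in B ∩ A, f θ ∂π).toReal := ENNReal.toReal_nonneg
  generalize (∫⁻ θ in B ∩ A, f θ ∂π).toReal = x at *
  generalize (∫⁻ θ in B, f θ ∂π).toReal = y at *
  generalize (∫⁻ θ in A, f θ ∂π).toReal = a at *
  generalize (∫⁻ θ, f θ ∂π).toReal = M at *
  have hM : 0 < M := r5.trans_le r4
  have e1 : x / M ≤ x / a := div_le_div_of_nonneg_left r6 r5 r4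
  have e2 : x / M ≤ y / M := by gcongr
  have e3 : y / M ≤ x / M + (1 - a / M) := by
    rw [← sub_nonneg]
    have : x / M + (1 - a / M) - y / M = (x + M - (y + a)) / M := by field_simp; ring
    rw [this]
    exact div_nonneg (by linarith) hM.le
  have e4 : x / a - x / M ≤ 1 - a / M := by
    have h : x / a - x / M = x / a * (1 - a / M) := by field_simp
    rw [h]
    have h2 : x / a ≤ 1 := (div_le_one r5).2 r1
    have h3 : 0 ≤ 1 - a / M := sub_nonneg.2 ((div_le_one hM).2 r4)
    exact (mul_le_mul_of_nonneg_right h2 h3).trans_eq (one_mul _)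
  rw [abs_le]
  constructor <;> linarith

/-- On `A`, e^{l + tW} lies between e^{l'} e^{t²/2 − η} and e^{l'} e^{t²/2 + η}. After division by
∫_A e^l the integral of e^{l'} is the given ratio, which is within η of 1. -/
lemma lintegral_exp_restrictedLaw_bounds {l l' W : Ω → ℝ} (hA : MeasurableSet A)
    (hl : Measurable l) (hW : Measurable W)
    {t η : ℝ} (hη1 : η < 1)
    (hlan : ∀ θ ∈ A, |l' θ - l θ - (t * W θ - t ^ 2 / 2)| ≤ η)
    (hr : |((∫⁻ θ in A, ENNReal.ofReal (Real.exp (l' θ)) ∂π) /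
      ∫⁻ θ in A, ENNReal.ofReal (Real.exp (l θ)) ∂π).toReal - 1| ≤ η) :
    ENNReal.ofReal (Real.exp (t ^ 2 / 2 - η) * (1 - η)) ≤
        ∫⁻ x, ENNReal.ofReal (Real.exp (t * x))
          ∂(restrictedLaw π (fun θ => ENNReal.ofReal (Real.exp (l θ))) A W) ∧
      ∫⁻ x, ENNReal.ofReal (Real.exp (t * x))
          ∂(restrictedLaw π (fun θ => ENNReal.ofReal (Real.exp (l θ))) A W) ≤
        ENNReal.ofReal (Real.exp (t ^ 2 / 2 + η) * (1 + η)) := by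
  rw [lintegral_restrictedLaw hW (by fun_prop) (by fun_prop)]
  set R := (∫⁻ θ in A, ENNReal.ofReal (Real.exp (l' θ)) ∂π) /
      ∫⁻ θ in A, ENNReal.ofReal (Real.exp (l θ)) ∂π with hR
  -- An infinite ratio would have `toReal` equal to 0, at distance 1 > η from 1.
  have hRtop : R ≠ ∞ := by
    intro h
    rw [h] at hr
    norm_num at hr
    linarith
  have hR1 : ENNReal.ofReal (1 - η) ≤ R := by
    rw [← ENNReal.ofReal_toReal hRtop]
    exact ENNReal.ofReal_le_ofReal (by linarith [(abs_le.1 hr).1])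
  have hR2 : R ≤ ENNReal.ofReal (1 + η) := by
    rw [← ENNReal.ofReal_toReal hRtop]
    exact ENNReal.ofReal_le_ofReal (by linarith [(abs_le.1 hr).2])
  rw [ENNReal.div_eq_inv_mul] at hR
  set c := (∫⁻ θ in A, ENNReal.ofReal (Real.exp (l θ)) ∂π)⁻¹
  have hprod : ∀ θ, ENNReal.ofReal (Real.exp (l θ)) * ENNReal.ofReal (Real.exp (t * W θ)) =
      ENNReal.ofReal (Real.exp (l θ + t * W θ)) := fun θ => by
    rw [← ENNReal.ofReal_mul (Real.exp_pos _).le, ← Real.exp_add]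
  simp_rw [hprod]
  constructor
  · calc ENNReal.ofReal (Real.exp (t ^ 2 / 2 - η) * (1 - η))
        ≤ ENNReal.ofReal (Real.exp (t ^ 2 / 2 - η)) * R := by
          rw [ENNReal.ofReal_mul (Real.exp_pos _).le]
          gcongr
      _ = c * ∫⁻ θ in A, ENNReal.ofReal (Real.exp (t ^ 2 / 2 - η)) *
            ENNReal.ofReal (Real.exp (l' θ)) ∂π := by
          rw [lintegral_const_mul' _ _ ENNReal.ofReal_ne_top, hR]
          ring
      _ ≤ _ := by
          gcongr c * ?_
          refine setLIntegral_mono' hA fun θ hθ => ?_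
          rw [← ENNReal.ofReal_mul (Real.exp_pos _).le, ← Real.exp_add]
          apply ENNReal.ofReal_le_ofReal
          rw [Real.exp_le_exp]
          linarith [(abs_le.1 (hlan θ hθ)).2]
  · calc c * ∫⁻ θ in A, ENNReal.ofReal (Real.exp (l θ + t * W θ)) ∂π
        ≤ c * ∫⁻ θ in A, ENNReal.ofReal (Real.exp (t ^ 2 / 2 + η)) *
            ENNReal.ofReal (Real.exp (l' θ)) ∂π := by
          gcongr c * ?_
          refine setLIntegral_mono' hA fun θ hθ => ?_
          rw [← ENNReal.ofReal_mul (Real.exp_pos _).le, ← Real.exp_add]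
          apply ENNReal.ofReal_le_ofReal
          rw [Real.exp_le_exp]
          linarith [(abs_le.1 (hlan θ hθ)).1]
      _ = ENNReal.ofReal (Real.exp (t ^ 2 / 2 + η)) * R := by
          rw [lintegral_const_mul' _ _ ENNReal.ofReal_ne_top, hR]
          ring
      _ ≤ _ := by
          rw [ENNReal.ofReal_mul (Real.exp_pos _).le]
          gcongr

end Posterior

/-! ### Deterministic bound on good data, and conclusion -/

section Assembly

variable {n p : ℕ}

/-- Here ‖Σ − Σ*‖² itself is at most δ/√n, so all directions are controlled at once; C² pays for Ω*,
and δ ≤ κ² gives the bound κ on the norm. -/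
lemma goodParam_of_mem_neighborhood (hn : n ≠ 0) {T : Truth p} {C δ κ : ℝ} (hT : T.BoundedBy C)
    (hκ : 0 < κ) (h1 : C ^ 2 * δ ≤ κ) (h2 : δ ≤ κ ^ 2) {θ : Param p}
    (hθ : θ ∈ T.neighborhood n δ) : GoodParam n T θ κ := by
  obtain ⟨hpd, hmax⟩ := hθ
  have hle := (le_max_left _ _).trans hmax
  have hC := hT.one_le
  have hnpos : 1 ≤ (n : ℝ) := by exact_mod_cast Nat.one_le_iff_ne_zero.2 hn
  set N := √(n : ℝ) with hN
  have hN1 : 1 ≤ N := Real.one_le_sqrt.2 hnpos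
  have hNpos : 0 < N := by linarith
  set e := specNorm (θ.cov - T.cov) with he
  have he0 : 0 ≤ e := specNorm_nonneg _
  have hsum : ‖θ.muX - T.muX‖ ^ 2 + ‖θ.muY - T.muY‖ ^ 2 + e ^ 2 ≤ δ / N := by
    rw [le_div_iff₀ hNpos, mul_comm]
    exact hle
  have hX := sq_nonneg ‖θ.muX - T.muX‖
  have hY := sq_nonneg ‖θ.muY - T.muY‖
  have he2 := sq_nonneg e
  have hδ0 : 0 ≤ δ := by
    have : 0 ≤ δ / N := by linarith
    by_contra! h
    exact absurd (div_neg_of_neg_of_pos h hNpos) (not_lt.2 this)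
  have hδκ : δ ≤ κ := by nlinarith [one_le_pow₀ hC (n := 2)]
  have hδN : δ / N ≤ κ / N := by gcongr
  have hcov : θ.cov.PosDef := hpd.inv
  have hdir : ∀ w : Vec p, ‖op (θ.cov - T.cov) (op T.prec w)‖ ^ 2 ≤ κ / N * ‖w‖ ^ 2 := by
    intro w
    have hb : ‖op (θ.cov - T.cov) (op T.prec w)‖ ≤ e * (C * ‖w‖) := by
      refine (norm_op_le _ _).trans ?_
      gcongr
      exact (norm_op_le _ _).trans (mul_le_mul_of_nonneg_right hT.prec_le (norm_nonneg _))
    calc _ ≤ (e * (C * ‖w‖)) ^ 2 := pow_le_pow_left₀ (norm_nonneg _) hb 2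
      _ = C ^ 2 * e ^ 2 * ‖w‖ ^ 2 := by ring
      _ ≤ C ^ 2 * (δ / N) * ‖w‖ ^ 2 := by
          gcongr
          linarith
      _ = C ^ 2 * δ / N * ‖w‖ ^ 2 := by ring
      _ ≤ _ := by gcongr
  refine ⟨hcov, ?_, ⟨hcov.isHermitian.sub T.posDef.isHermitian, by linarith, by linarith, hdir _,
    hdir _, hdir _, hdir _⟩, ?_, by linarith⟩
  · exact (Matrix.nonsing_inv_nonsing_inv _ hpd.det_pos.ne'.isUnit).symm
  · apply le_of_sq_le_sq _ hκ.le
    have : δ / N ≤ δ := div_le_self hδ0 hN1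
    linarith

/-- One ε accounts for the posterior mass outside `A`, the other for the distance of the restricted
law to N(0,1). -/
lemma cdfDistance_le (hn : n ≠ 0) {T : Truth p} {C : ℝ} (hT : T.BoundedBy C) (hV : 0 < T.V)
    (hVC : T.V⁻¹ ≤ C) {prior : Measure (Param p)} {A : Set (Param p)}
    (hA : MeasurableSet A) {D : Data n p} {κ ε η η' : ℝ} {F : Finset ℝ} (hε : 0 ≤ ε)
    (hF : ∀ ν : ProbabilityMeasure ℝ,
      (∀ t ∈ F,
        ENNReal.ofReal (Real.exp (t ^ 2 / 2) - η) ≤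
          ∫⁻ x, ENNReal.ofReal (Real.exp (t * x)) ∂(ν : Measure ℝ) ∧
        ∫⁻ x, ENNReal.ofReal (Real.exp (t * x)) ∂(ν : Measure ℝ) ≤
          ENNReal.ofReal (Real.exp (t ^ 2 / 2) + η)) →
      ∀ s, |(ν : Measure ℝ).real (Set.Iic s) - (gaussianReal 0 1).real (Set.Iic s)| ≤ ε)
    (hη1 : η' < 1)
    (hη : ∀ t ∈ F, Real.exp (t ^ 2 / 2) - η ≤ Real.exp (t ^ 2 / 2 - η') * (1 - η') ∧
      Real.exp (t ^ 2 / 2 + η') * (1 + η') ≤ Real.exp (t ^ 2 / 2) + η)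
    (hκ0 : 1 / √(n : ℝ) ≤ κ) (hκ1 : C * κ ≤ 1 / 2)
    (hκt : ∀ t ∈ F, 4 * |t| * C ^ 2 * κ ≤ 1 / 2 ∧
      (128 * |t| ^ 3 * C ^ 6 + 8 * C ^ 3 * |t| + 6 * t ^ 2 * C ^ 3 + 2 * C ^ 4 * t ^ 2
        + (16 * |t| * C + 4 * |t| ^ 3 * C ^ 3) + |t| * (24 * C ^ 4 + 8 * C ^ 2)) * κ ≤ η')
    (hD : GoodData T D κ) (hgood : ∀ θ ∈ A, GoodParam n T θ κ)
    (hpost : |1 - posterior prior D A| ≤ ε) (hpost1 : |1 - posterior prior D A| < 1)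
    (hratio : ∀ t ∈ F, |perturbedRatio T prior A t D - 1| ≤ η') :
    cdfDistance T prior D ≤ 2 * ε := by
  have hl := measurable_logLik hn D
  have hW := measurable_stat T D
  set f : Param p → ℝ≥0∞ := fun θ => ENNReal.ofReal (Real.exp (logLik D θ)) with hf
  have hpos : 0 < ((∫⁻ θ in A, f θ ∂prior) / ∫⁻ θ, f θ ∂prior).toReal := by
    have := (abs_lt.1 hpost1).2
    simp only [posterior] at this
    linarith
  -- A positive `toReal` excludes the degenerate quotients: the mass of `A` is nonzero and the total
  -- mass is finite, so the restricted law is a probability measure.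
  obtain ⟨hq0, -⟩ := ENNReal.toReal_pos_iff.1 hpos
  obtain ⟨h0, h1⟩ := ENNReal.div_ne_zero.1 hq0.ne'
  have h2 : ∫⁻ θ in A, f θ ∂prior ≠ ∞ := ne_top_of_le_ne_top h1 (setLIntegral_le_lintegral A f)
  have hprob := isProbabilityMeasure_restrictedLaw hW h0 h2
  have hkol := hF ⟨restrictedLaw prior f A (stat T D), hprob⟩ (by
    intro t ht
    have hb := lintegral_exp_restrictedLaw_bounds (π := prior) (A := A)
      (l' := fun θ => logLik D (T.perturb n t θ)) hA hl hW hη1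
      (fun θ hθ => (abs_logLik_perturb_sub_le hn hT hV hVC hD (hgood θ hθ) t hκ0 hκ1
        (hκt t ht).1).trans (hκt t ht).2) (hratio t ht)
    exact ⟨(ENNReal.ofReal_le_ofReal (hη t ht).1).trans hb.1,
      hb.2.trans (ENNReal.ofReal_le_ofReal (hη t ht).2)⟩)
  refine Real.iSup_le (fun s => ?_) (by linarith)
  have e1 := abs_ratio_sub_restrictedLaw_le (π := prior) hA hW h0 h1 s
  have e2 := hkol s
  have e3 : 1 - ((∫⁻ θ in A, f θ ∂prior) / ∫⁻ θ, f θ ∂prior).toReal ≤ ε :=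
    (le_abs_self _).trans hpost
  change |((∫⁻ θ in {θ | stat T D θ ≤ s}, f θ ∂prior) / ∫⁻ θ, f θ ∂prior).toReal - _| ≤ _
  refine (abs_sub_le _ ((restrictedLaw prior f A (stat T D)).real (Set.Iic s)) _).trans ?_
  exact (add_le_add (e1.trans e3) e2).trans_eq (two_mul ε).symm

end Assembly

end LDA

theorem mainTheorem5
    (p : ℕ → ℕ)
    (T : ∀ n, LDA.Truth (p n))
    (prior : ∀ n, Measure (LDA.Param (p n)))
    [∀ n, IsProbabilityMeasure (prior n)]
    (hprior : ∀ n, ∀ᵐ θ ∂(prior n), θ.prec.PosDef)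
    (A : ∀ n, Set (LDA.Param (p n)))
    (hA_meas : ∀ n, MeasurableSet (A n))
    (δ : ℕ → ℝ)
    (hδ : Tendsto δ atTop (𝓝 0))
    (hA : ∀ n, A n ⊆ (T n).neighborhood n (δ n))
    (hbound : ∃ C : ℝ, ∀ᶠ n in atTop,
      max (LDA.specNorm (T n).cov) (LDA.specNorm (T n).prec) ≤ C)
    (hp : Tendsto (fun n => (p n : ℝ) ^ 2 / (n : ℝ)) atTop (𝓝 0))
    (hV : ∃ C : ℝ, ∀ᶠ n in atTop, 0 < (T n).V ∧ ((T n).V)⁻¹ ≤ C)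
    (hconc : LDA.IsLittleOP (fun n => (T n).dataLaw n)
      (fun n D => 1 - LDA.posterior (prior n) D (A n)))
    (hpert : ∀ t : ℝ, LDA.IsLittleOP (fun n => (T n).dataLaw n)
      (fun n D => LDA.perturbedRatio (T n) (prior n) (A n) t D - 1)) :
    LDA.IsLittleOP (fun n => (T n).dataLaw n)
      (fun n D => LDA.cdfDistance (T n) (prior n) D) := by
  intro ε hε
  obtain ⟨C₁, hC₁⟩ := hbound
  obtain ⟨C₂, hC₂⟩ := hV
  set C := max 1 (max C₁ C₂) with hC
  have hC1 : 1 ≤ C := le_max_left _ _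
  have hC1C : C₁ ≤ C := (le_max_left _ _).trans (le_max_right _ _)
  have hC2C : C₂ ≤ C := (le_max_right _ _).trans (le_max_right _ _)
  have hT : ∀ᶠ n in atTop, (T n).BoundedBy C := by
    filter_upwards [hC₁] with n hn
    exact ⟨hC1, ((le_max_left _ _).trans hn).trans hC1C, ((le_max_right _ _).trans hn).trans hC1C⟩
  obtain ⟨F, η, hη, hF⟩ := LDA.exists_finset_kolmogorov_le (show 0 < ε / 4 by linarith)
  -- Constants are chosen backwards: ε gives `F` and η, then η' bounds both the expansion error and
  -- the ratio error, and then κ makes the expansion error at most η' for all `t` in `F`.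
  obtain ⟨η', hη'F, hη'1, hη'0⟩ : ∃ η' : ℝ, (∀ t ∈ F,
      Real.exp (t ^ 2 / 2) - η ≤ Real.exp (t ^ 2 / 2 - η') * (1 - η') ∧
      Real.exp (t ^ 2 / 2 + η') * (1 + η') ≤ Real.exp (t ^ 2 / 2) + η) ∧ η' < 1 ∧ 0 < η' := by
    have h1 : ∀ᶠ x : ℝ in 𝓝[>] 0, ∀ t ∈ F,
        Real.exp (t ^ 2 / 2) - η ≤ Real.exp (t ^ 2 / 2 - x) * (1 - x) ∧
        Real.exp (t ^ 2 / 2 + x) * (1 + x) ≤ Real.exp (t ^ 2 / 2) + η := by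
      rw [Filter.eventually_all_finset]
      intro t _
      refine eventually_nhdsWithin_of_eventually_nhds (Eventually.and ?_ ?_)
      · have hc : Continuous fun x : ℝ => Real.exp (t ^ 2 / 2 - x) * (1 - x) := by fun_prop
        refine (hc.tendsto 0).eventually_const_le ?_
        simp [hη]
      · have hc : Continuous fun x : ℝ => Real.exp (t ^ 2 / 2 + x) * (1 + x) := by fun_prop
        refine (hc.tendsto 0).eventually_le_const ?_
        simp [hη]
    have h2 : ∀ᶠ x : ℝ in 𝓝[>] 0, x < 1 :=
      eventually_nhdsWithin_of_eventually_nhds (eventually_lt_nhds one_pos)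
    obtain ⟨x, hx1, hx2, hx3⟩ := (h1.and (h2.and self_mem_nhdsWithin)).exists
    exact ⟨x, hx1, hx2, hx3⟩
  obtain ⟨κ, hκt, hκ1, hκ0⟩ : ∃ κ : ℝ, (∀ t ∈ F, 4 * |t| * C ^ 2 * κ ≤ 1 / 2 ∧
      (128 * |t| ^ 3 * C ^ 6 + 8 * C ^ 3 * |t| + 6 * t ^ 2 * C ^ 3 + 2 * C ^ 4 * t ^ 2
        + (16 * |t| * C + 4 * |t| ^ 3 * C ^ 3) + |t| * (24 * C ^ 4 + 8 * C ^ 2)) * κ ≤ η') ∧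
      C * κ ≤ 1 / 2 ∧ 0 < κ := by
    have hsmall : ∀ K b : ℝ, 0 < b → ∀ᶠ x : ℝ in 𝓝[>] 0, K * x ≤ b := by
      intro K b hb
      have hc : Continuous fun x : ℝ => K * x := by fun_prop
      refine eventually_nhdsWithin_of_eventually_nhds ((hc.tendsto 0).eventually_le_const ?_)
      simpa using hb
    have h1 := (Filter.eventually_all_finset F).2 fun t (_ : t ∈ F) =>
      (hsmall (4 * |t| * C ^ 2) (1 / 2) (by norm_num)).and (hsmall (128 * |t| ^ 3 * C ^ 6
        + 8 * C ^ 3 * |t| + 6 * t ^ 2 * C ^ 3 + 2 * C ^ 4 * t ^ 2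
        + (16 * |t| * C + 4 * |t| ^ 3 * C ^ 3) + |t| * (24 * C ^ 4 + 8 * C ^ 2)) η' hη'0)
    obtain ⟨x, hx1, hx2, hx3⟩ :=
      (h1.and ((hsmall C (1 / 2) (by norm_num)).and self_mem_nhdsWithin)).exists
    exact ⟨x, hx1, hx2, hx3⟩
  -- The bound 1/2 keeps the posterior mass of `A n` positive; ε/4 leads to a distance of at most
  -- ε/2 < ε.
  set ε₁ := min (ε / 4) (1 / 2) with hε₁
  have hε₁0 : 0 < ε₁ := lt_min (by linarith) (by norm_num)
  -- Finiteness of `F` is what allows a union bound over the ratio events.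
  have hlim := ((LDA.tendsto_dataLaw_not_goodData hT hp hκ0).add (hconc ε₁ hε₁0)).add
    (tendsto_finsetSum F fun t _ => hpert t η' hη'0)
  simp only [Finset.sum_const_zero, add_zero] at hlim
  refine tendsto_of_tendsto_of_tendsto_of_le_of_le' tendsto_const_nhds hlim
    (Eventually.of_forall fun _ => zero_le) ?_
  have hδ1 : ∀ᶠ n in atTop, C ^ 2 * δ n ≤ κ :=
    (hδ.const_mul (C ^ 2)).eventually_le_const (by simpa using hκ0)
  have hδ2 : ∀ᶠ n in atTop, δ n ≤ κ ^ 2 := hδ.eventually_le_const (by positivity)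
  have hN : ∀ᶠ n : ℕ in atTop, 1 / √(n : ℝ) ≤ κ := by
    have h : Tendsto (fun n : ℕ => 1 / √(n : ℝ)) atTop (𝓝 0) :=
      (Real.tendsto_sqrt_atTop.comp tendsto_natCast_atTop_atTop).const_div_atTop 1
    exact h.eventually_le_const hκ0
  filter_upwards [hT, hC₂, hδ1, hδ2, hN, eventually_ne_atTop 0] with n hTn hVn hδ1n hδ2n hNn hn0
  have hsub : {D | ε ≤ |LDA.cdfDistance (T n) (prior n) D|} ⊆
      ({D | ¬ LDA.GoodData (T n) D κ} ∪ {D | ε₁ ≤ |1 - LDA.posterior (prior n) D (A n)|}) ∪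
      ⋃ t ∈ F, {D : LDA.Data n (p n) |
        η' ≤ |LDA.perturbedRatio (T n) (prior n) (A n) t D - 1|} := by
    intro D hD
    by_contra! hcon
    simp only [Set.mem_union, Set.mem_iUnion, Set.mem_ofPred_eq, not_or, not_exists, not_not,
      not_le] at hcon
    obtain ⟨⟨hgood, hpost⟩, hratio⟩ := hcon
    have h := LDA.cdfDistance_le hn0 hTn hVn.1 (hVn.2.trans hC2C) (hA_meas n)
      (show 0 ≤ ε / 4 by linarith) hF hη'1 hη'F hNn hκ1 hκt hgood
      (fun θ hθ => LDA.goodParam_of_mem_neighborhood hn0 hTn hκ0 hδ1n hδ2n (hA n hθ))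
      (hpost.le.trans (min_le_left _ _)) (hpost.trans_le ((min_le_right _ _).trans (by norm_num)))
      (fun t ht => (hratio t ht).le)
    have h0 : 0 ≤ LDA.cdfDistance (T n) (prior n) D := Real.iSup_nonneg fun _ => abs_nonneg _
    have hD' : ε ≤ |LDA.cdfDistance (T n) (prior n) D| := hD
    rw [abs_of_nonneg h0] at hD'
    linarith
  refine (measure_mono hsub).trans ((measure_union_le _ _).trans (add_le_add (measure_union_le _ _)
    (measure_biUnion_finset_le _ _)))
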